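/- Let $K$ be a continuous function on the circle $S^1=\mathbb R/\mathbb Z$ with $\int_0^1 K(x)\,dx=1$, and let $q$ be a Gaussian process indexed by $S^1$ with almost surely continuous paths, $E[q(x)]=0$ and $E[q(x)q(y)]=K(x-y)$. Let $\Lambda_0(q)$ be the smallest eigenvalue of Hill's operator $-\frac{d^2}{dx^2}+q(x)$ on $S^1$ (periodic boundary conditions). Let $H$ be the space of continuous mean-zero functions on $S^1$, and let $\tilde P$ be the law on $H$ of $\tilde q=q-\int_0^1 q$. Let $\lambda\in\mathbb R$. For every $\tilde q\in H$ and every $s>0$ there is a unique periodic mean-zero function $\tilde p=\tilde p_{s,\tilde q}$ with $$\tilde q=\tilde p'+\tilde p^2-\int_0^1\tilde p^2+2s\tilde p .$$ Put $\Phi(s,\tilde q)=\int_0^1\tilde p_{s,\tilde q}^2$. Thus, with $q_0=\lambda+\Phi(s,\tilde q)+s^2$, the function $p=\tilde p+s$ solves Riccati's equation $q_0+\tilde q=\lambda+p'+p^2$ and $s=\int_0^1p$ is its log-multiplier. For fixed $\tilde q\in H$, the map $s\mapsto q_0=\lambda+\Phi(s,\tilde q)+s^2$ is a bijection from $(0,\infty)$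 onto $\{q_0\in\mathbb R:\Lambda_0(q_0+\tilde q)>\lambda\}$, and for every $s>0$ it has derivative $\partial q_0/\partial s=J(s,\tilde q)>0$, where $$J(s,\tilde q)^{-1}=\frac{1}{1-e^{-2s}}\int_0^1\!\int_0^1 e^{2\int_0^x(\tilde p+s)}e^{-2\int_0^y(\tilde p+s)}\,dy\,dx-\int_0^1\!\int_0^x e^{2\int_0^x(\tilde p+s)}e^{-2\int_0^y(\tilde p+s)}\,dy\,dx .$$ Moreover $$P\bigl(\Lambda_0(q)>\lambda\bigr)=\frac1{\sqrt{2\pi}}\int_H\int_0^\infty e^{-\frac12\left(\lambda+\Phi(s,\tilde q)+s^2\right)^2}J(s,\tilde q)\,ds\,d\tilde P(\tilde q),$$ where the event on the left is measurable (for the completion of $P$) and the integrand on the right is integrable for $\tilde P\otimes ds$. -/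

import Mathlib

open MeasureTheory ProbabilityTheory

noncomputable section

/-- The space `H` of continuous real functions of mean zero on the circle `ℝ / ℤ`. -/
abbrev MeanZeroPath : Type := {f : C(UnitAddCircle, ℝ) // ∫ x, f x = 0}

/-- `H` carries the Borel σ-algebra of the uniform topology. -/
instance : MeasurableSpace MeanZeroPath := borel MeanZeroPath

instance : BorelSpace MeanZeroPath := ⟨rfl⟩

/-- `lam` is an eigenvalue of Hill's operator `-d²/dx² + f` on the circle, that is, with periodic
boundary conditions: there is a nonzero `1`-periodic `ψ` with `-ψ'' + f ψ = lam ψ`. -/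
def IsHillEigenvalue (f : C(UnitAddCircle, ℝ)) (lam : ℝ) : Prop :=
  ∃ ψ dψ : ℝ → ℝ, ψ ≠ 0 ∧ Function.Periodic ψ 1 ∧
    (∀ x : ℝ, HasDerivAt ψ (dψ x) x) ∧
    (∀ x : ℝ, HasDerivAt dψ ((f (x : UnitAddCircle) - lam) * ψ x) x)

/-- The ground state eigenvalue `Λ₀(f)`: the smallest eigenvalue of `-d²/dx² + f`. -/
def groundState (f : C(UnitAddCircle, ℝ)) : ℝ := sInf {lam | IsHillEigenvalue f lam}

/-- The mean-zero part `f - ∫ f` of a path. -/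
def meanZeroPart (f : C(UnitAddCircle, ℝ)) : MeanZeroPath :=
  ⟨f - ContinuousMap.const _ (∫ x, f x), by
    have hf : Integrable (fun x => f x) (volume : Measure UnitAddCircle) :=
      f.continuous.integrable_of_hasCompactSupport
        (HasCompactSupport.of_compactSpace _)
    simp only [ContinuousMap.sub_apply, ContinuousMap.const_apply]
    rw [integral_sub hf (integrable_const _)]
    simp [Measure.real]⟩

/-- The sample path of a process indexed by the circle, at an outcome where it is continuous
(and `0` at the other outcomes). -/
def samplePath {Ω : Type*} (q : UnitAddCircle → Ω → ℝ) (ω : Ω) : C(UnitAddCircle, ℝ) :=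
  open Classical in
  if h : Continuous (fun x => q x ω) then ⟨fun x => q x ω, h⟩ else 0

/-- The law `P̃` on `H` of the mean-zero part of the process `q`. -/
def meanZeroLaw {Ω : Type*} [MeasurableSpace Ω] (P : Measure Ω) (q : UnitAddCircle → Ω → ℝ) :
    Measure MeanZeroPath :=
  P.map (fun ω => meanZeroPart (samplePath q ω))

/-- `p` is a `1`-periodic mean-zero solution of `qt = p' + p² - ∫₀¹ p² + 2 s p`, the projection of
Riccati's equation `q = lam + (p + s)' + (p + s)²` off the constants. -/
structure IsRiccatiSolution (s : ℝ) (qt : MeanZeroPath) (p : ℝ → ℝ) : Prop where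
  periodic : Function.Periodic p 1
  mean_zero : ∫ x in (0 : ℝ)..1, p x = 0
  ode : ∀ x : ℝ, HasDerivAt p
    (qt.1 (x : UnitAddCircle) - p x ^ 2 + (∫ y in (0 : ℝ)..1, p y ^ 2) - 2 * s * p x) x

/-- The path `p̃` determined by the log-multiplier `s` and the mean-zero potential `qt`. -/
def riccati (s : ℝ) (qt : MeanZeroPath) : ℝ → ℝ :=
  open Classical in
  if h : ∃ p, IsRiccatiSolution s qt p then h.choose else 0

/-- `Φ = ∫₀¹ p̃²`, for `p̃` at log-multiplier `s`. -/
def Phi (s : ℝ) (qt : MeanZeroPath) : ℝ := ∫ x in (0 : ℝ)..1, riccati s qt x ^ 2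

/-- `∫₀ˣ (p̃ + s)`. -/
def riccatiPrimitive (s : ℝ) (qt : MeanZeroPath) (x : ℝ) : ℝ :=
  ∫ t in (0 : ℝ)..x, (riccati s qt t + s)

/-- The reciprocal of the Jacobian factor. -/
def jacobianInv (s : ℝ) (qt : MeanZeroPath) : ℝ :=
  1 / (1 - Real.exp (-2 * s)) *
      (∫ x in (0 : ℝ)..1, ∫ y in (0 : ℝ)..1,
        Real.exp (2 * riccatiPrimitive s qt x) * Real.exp (-2 * riccatiPrimitive s qt y)) -
    ∫ x in (0 : ℝ)..1, ∫ y in (0 : ℝ)..x,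
      Real.exp (2 * riccatiPrimitive s qt x) * Real.exp (-2 * riccatiPrimitive s qt y)

/-- The Jacobian factor `J(s, q̃)`. -/
def jacobian (s : ℝ) (qt : MeanZeroPath) : ℝ := (jacobianInv s qt)⁻¹

end

open MeasureTheory ProbabilityTheory Filter Topology

/-! ### Linear first order equations with periodic boundary conditions -/

/-! Write `q = q₀ + q̃` with `q₀ = ∫ q`. Two facts combine: for fixed `q̃` the event `Λ₀ > lam` is a
half-line in `q₀`, which `s` parametrizes smoothly, and `q₀` is a standard Gaussian independent of
`q̃`.

Everything deterministic rests on the periodic linear problem `w' = k + g - a w` with `∫ a ≥ 0`,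
where both `w` and the constant `k` are unknown and the mean of `w` is prescribed. The extra unknown
`k` keeps the problem well posed even when `∫ a = 0`. Riccati's equation reduces to it exactly:
since `P₁² - P₂² = (P₁ + P₂)(P₁ - P₂)`, the difference of two paths `P = p̃ + s` solves such a
linear equation with `a = P₁ + P₂` (`IsRiccatiSolution.hasDerivAt_sub`). This gives uniqueness and
continuity in the parameters. It also gives a closed formula for the difference quotient of `q₀` in
`s`, whose limit is `J` (`sub_mul_jacobianInvOf`, `hasDerivAt_Phi_add_sq`). Existence is a
continuity method: the range of the Riccati operator is open, closed and nonempty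
(`surjective_riccatiOp`).

At `s = 0` the function `exp (∫ p̃)` is a periodic eigenfunction. For smaller energies, the
factorization of Hill's operator by the path with `s > 0` excludes eigenfunctions. Hence `Λ₀(q₀ +
q̃) = q₀ - Φ(0, q̃)` (`groundState_const_add`).

Since `∫ K = 1`, the mean has variance `1` and covariance `1` with every `q(x)`. It is therefore
uncorrelated with `q̃`, and joint Gaussianity gives independence
(`indepFun_circleMean_meanZeroPart`). The probability is thus the `P̃`-average of the Gaussian tails
beyond `lam + Φ(0, q̃)`, and the substitution `q₀ = lam + Φ + s²` turns each tail into the integral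
over `s`. -/

theorem hasDerivAt_exp_primitive {a : ℝ → ℝ} (ha : Continuous a) (x : ℝ) :
    HasDerivAt (fun x => Real.exp (∫ t in (0 : ℝ)..x, a t))
      (Real.exp (∫ t in (0 : ℝ)..x, a t) * a x) x :=
  ((ha.integral_hasStrictDerivAt 0 x).hasDerivAt).exp

theorem continuous_exp_primitive {a : ℝ → ℝ} (ha : Continuous a) :
    Continuous (fun x => Real.exp (∫ t in (0 : ℝ)..x, a t)) :=
  continuous_iff_continuousAt.2 fun x => (hasDerivAt_exp_primitive ha x).continuousAt

theorem hasDerivAt_mul_exp_primitive {a g w : ℝ → ℝ} {k : ℝ} (ha : Continuous a)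
    (hw : ∀ x, HasDerivAt w (k + g x - a x * w x) x) (x : ℝ) :
    HasDerivAt (fun x => w x * Real.exp (∫ t in (0 : ℝ)..x, a t))
      (Real.exp (∫ t in (0 : ℝ)..x, a t) * (k + g x)) x := by
  refine ((hw x).mul (hasDerivAt_exp_primitive ha x)).congr_deriv ?_
  ring

theorem mul_exp_primitive_eq {a g w : ℝ → ℝ} {k : ℝ} (ha : Continuous a) (hg : Continuous g)
    (hw : ∀ x, HasDerivAt w (k + g x - a x * w x) x) (x : ℝ) :
    w x * Real.exp (∫ t in (0 : ℝ)..x, a t) =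
      w 0 + ∫ y in (0 : ℝ)..x, Real.exp (∫ t in (0 : ℝ)..y, a t) * (k + g y) := by
  rw [intervalIntegral.integral_eq_sub_of_hasDerivAt
    (fun y _ => hasDerivAt_mul_exp_primitive ha hw y)
    (((continuous_exp_primitive ha).mul (continuous_const.add hg)).intervalIntegrable _ _)]
  simp

/-! ### Stability estimates for the periodic linear problem -/

theorem abs_primitive_le {a : ℝ → ℝ} {R x : ℝ} (hR : ∀ x, |a x| ≤ R) (h0 : 0 ≤ x) (h1 : x ≤ 1) :
    |∫ t in (0 : ℝ)..x, a t| ≤ R := by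
  have h := intervalIntegral.norm_integral_le_of_norm_le_const (a := 0) (b := x) (f := a) (C := R)
    fun x _ => hR x
  have hR0 : 0 ≤ R := (abs_nonneg _).trans (hR 0)
  rw [Real.norm_eq_abs, sub_zero, abs_of_nonneg h0] at h
  exact h.trans (mul_le_of_le_one_right hR0 h1)

/-- If `k > N`, then `w exp (∫ a)` grows at rate at least `(k - N) exp (-R)`. Periodicity and `∫ a ≥
0` then force `w 0 > 0`, so `w x ≥ (k - N) exp (-2R) x` on the unit interval, and integrating bounds
`k - N`. The constant does not degenerate as `∫ a` tends to `0`, which makes `s = 0` accessible. -/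
theorem const_le_of_periodic_linear_ode {a g w : ℝ → ℝ} {k R N : ℝ} (ha : Continuous a)
    (hg : Continuous g) (hw : ∀ x, HasDerivAt w (k + g x - a x * w x) x) (hper : w 1 = w 0)
    (hσ : 0 ≤ ∫ x in (0 : ℝ)..1, a x) (hR : ∀ x, |a x| ≤ R) (hN : ∀ x, |g x| ≤ N) :
    k ≤ N + 2 * Real.exp (2 * R) * |∫ x in (0 : ℝ)..1, w x| := by
  by_contra! hk
  have hkN : 0 < k - N := by
    have : 0 ≤ 2 * Real.exp (2 * R) * |∫ x in (0 : ℝ)..1, w x| := by positivity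
    linarith
  have hwc : Continuous w := continuous_iff_continuousAt.2 fun x => (hw x).continuousAt
  set E : ℝ → ℝ := fun x => Real.exp (∫ t in (0 : ℝ)..x, a t) with hE
  have hEc : Continuous E := continuous_exp_primitive ha
  have hlow : ∀ x, 0 ≤ x → x ≤ 1 → w 0 + (k - N) * Real.exp (-R) * x ≤ w x * E x := by
    intro x h0 h1
    have h := mul_exp_primitive_eq ha hg hw x
    have h2 : ∫ y in (0 : ℝ)..x, (k - N) * Real.exp (-R) ≤
        ∫ y in (0 : ℝ)..x, E y * (k + g y) := by
      refine intervalIntegral.integral_mono_on h0 (by simp)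
        ((hEc.mul (continuous_const.add hg)).intervalIntegrable _ _) fun y hy => ?_
      rw [mul_comm]
      refine mul_le_mul (Real.exp_le_exp.2 ?_) ?_ hkN.le (Real.exp_pos _).le
      · exact (abs_le.1 (abs_primitive_le hR hy.1 (hy.2.trans h1))).1
      · have := (abs_le.1 (hN y)).1; linarith
    rw [intervalIntegral.integral_const, smul_eq_mul, sub_zero] at h2
    change w x * E x = _ + ∫ y in (0 : ℝ)..x, E y * (k + g y) at h
    linarith
  have hE1 : 1 ≤ E 1 := Real.one_le_exp hσ
  have hw0 : 0 < w 0 := by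
    have h := hlow 1 zero_le_one le_rfl
    rw [hper, mul_one] at h
    have h3 : 0 < (k - N) * Real.exp (-R) := by positivity
    by_contra! hneg
    nlinarith
  have hlow' : ∀ x ∈ Set.Icc (0 : ℝ) 1, (k - N) * Real.exp (-(2 * R)) * x ≤ w x := by
    intro x hx
    have h := hlow x hx.1 hx.2
    have hEx : E x ≤ Real.exp R :=
      Real.exp_le_exp.2 (abs_le.1 (abs_primitive_le hR hx.1 hx.2)).2
    have hEpos : 0 < E x := Real.exp_pos _
    have h4 : (k - N) * Real.exp (-(2 * R)) * x * E x ≤ w x * E x := by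
      calc (k - N) * Real.exp (-(2 * R)) * x * E x
          ≤ (k - N) * Real.exp (-(2 * R)) * x * Real.exp R := by
            have := hx.1
            gcongr
        _ = (k - N) * (Real.exp (-(2 * R)) * Real.exp R) * x := by ring
        _ = (k - N) * Real.exp (-R) * x := by rw [← Real.exp_add]; ring_nf
        _ ≤ w x * E x := by linarith
    exact le_of_mul_le_mul_right h4 hEpos
  have hint : ∫ x in (0 : ℝ)..1, (k - N) * Real.exp (-(2 * R)) * x ≤ ∫ x in (0 : ℝ)..1, w x :=
    intervalIntegral.integral_mono_on zero_le_one
      ((continuous_const.mul continuous_id).intervalIntegrable (0 : ℝ) 1)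
      (hwc.intervalIntegrable (0 : ℝ) 1) hlow'
  rw [intervalIntegral.integral_const_mul, integral_id] at hint
  have h5 := hint.trans (le_abs_self _)
  have h6 : Real.exp (2 * R) * Real.exp (-(2 * R)) = 1 := by rw [← Real.exp_add]; simp
  have h7 : k - N ≤ 2 * Real.exp (2 * R) * |∫ x in (0 : ℝ)..1, w x| := by
    calc k - N = 2 * Real.exp (2 * R) * ((k - N) * Real.exp (-(2 * R)) * ((1 ^ 2 - 0 ^ 2) / 2)) := by
          linear_combination -(k - N) * h6
      _ ≤ _ := by gcongr
  linarith

theorem abs_const_le_of_periodic_linear_ode {a g w : ℝ → ℝ} {k R N : ℝ} (ha : Continuous a)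
    (hg : Continuous g) (hw : ∀ x, HasDerivAt w (k + g x - a x * w x) x) (hper : w 1 = w 0)
    (hσ : 0 ≤ ∫ x in (0 : ℝ)..1, a x) (hR : ∀ x, |a x| ≤ R) (hN : ∀ x, |g x| ≤ N) :
    |k| ≤ N + 2 * Real.exp (2 * R) * |∫ x in (0 : ℝ)..1, w x| := by
  refine abs_le'.2 ⟨const_le_of_periodic_linear_ode ha hg hw hper hσ hR hN, ?_⟩
  have h := const_le_of_periodic_linear_ode (w := fun x => -w x) (g := fun x => -g x) (k := -k)
    ha hg.neg (fun x => ((hw x).neg).congr_deriv (by ring)) (by simp [hper]) hσ hR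
    (fun x => by simpa using hN x)
  simpa using h

theorem abs_le_of_periodic_linear_ode {a g w : ℝ → ℝ} {k R N : ℝ} (ha : Continuous a)
    (hg : Continuous g) (hw : ∀ x, HasDerivAt w (k + g x - a x * w x) x)
    (hR : ∀ x, |a x| ≤ R) (hN : ∀ x, |g x| ≤ N) {x : ℝ} (hx : x ∈ Set.Icc (0 : ℝ) 1) :
    |w x| ≤ Real.exp (2 * R) * (|∫ x in (0 : ℝ)..1, w x| + |k| + N) := by
  have hwc : Continuous w := continuous_iff_continuousAt.2 fun x => (hw x).continuousAt
  set r := ∫ x in (0 : ℝ)..1, w x with hr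
  -- The mean of `w` is attained at some `c`; integrating the equation from `c` instead of `0`
  -- replaces an initial value by the mean.
  obtain ⟨c, hc, hcr⟩ : ∃ c ∈ Set.Ioo (0 : ℝ) 1, w c = r := by
    obtain ⟨c, hc, h⟩ := exists_hasDerivAt_eq_slope (fun x => ∫ t in (0 : ℝ)..x, w t) w zero_lt_one
      (intervalIntegral.continuous_primitive (fun _ _ => hwc.intervalIntegrable _ _) _).continuousOn
      fun x _ => (hwc.integral_hasStrictDerivAt 0 x).hasDerivAt
    exact ⟨c, hc, by simpa using h⟩
  set E : ℝ → ℝ := fun x => Real.exp (∫ t in (0 : ℝ)..x, a t) with hE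
  have hEc : Continuous E := continuous_exp_primitive ha
  have hEle : ∀ y ∈ Set.Icc (0 : ℝ) 1, E y ≤ Real.exp R := fun y hy =>
    Real.exp_le_exp.2 (abs_le.1 (abs_primitive_le hR hy.1 hy.2)).2
  have hEge : Real.exp (-R) ≤ E x :=
    Real.exp_le_exp.2 (abs_le.1 (abs_primitive_le hR hx.1 hx.2)).1
  have hEpos : ∀ y, 0 < E y := fun y => Real.exp_pos _
  have hdiff : |w x * E x - w c * E c| ≤ Real.exp R * (|k| + N) := by
    have h := intervalIntegral.integral_eq_sub_of_hasDerivAt (a := c) (b := x)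
      (fun y _ => hasDerivAt_mul_exp_primitive ha hw y)
      ((hEc.mul (continuous_const.add hg)).intervalIntegrable _ _)
    have h2 := intervalIntegral.norm_integral_le_of_norm_le_const (a := c) (b := x)
      (f := fun y => E y * (k + g y)) (C := Real.exp R * (|k| + N)) fun y hy => by
        have hy' : y ∈ Set.Icc (0 : ℝ) 1 :=
          (Set.uIcc_subset_Icc ⟨hc.1.le, hc.2.le⟩ hx) (Set.uIoc_subset_uIcc hy)
        rw [Real.norm_eq_abs, abs_mul, abs_of_pos (hEpos y)]
        exact mul_le_mul (hEle y hy') ((abs_add_le _ _).trans (by linarith [hN y])) (abs_nonneg _)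
          (Real.exp_pos _).le
    rw [h, Real.norm_eq_abs] at h2
    refine h2.trans (mul_le_of_le_one_right ?_ ?_)
    · have := (abs_nonneg _).trans (hN 0); positivity
    · rw [abs_le]; constructor <;> linarith [hc.1, hc.2, hx.1, hx.2]
  have h3 : |w x| * E x ≤ Real.exp R * (|r| + |k| + N) := by
    rw [← abs_of_pos (hEpos x), ← abs_mul]
    have h4 : |w c * E c| ≤ |r| * Real.exp R := by
      rw [abs_mul, hcr, abs_of_pos (hEpos c)]
      exact mul_le_mul_of_nonneg_left (hEle c ⟨hc.1.le, hc.2.le⟩) (abs_nonneg _)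
    have h5 := abs_sub_abs_le_abs_sub (w x * E x) (w c * E c)
    linarith
  have h6 : |w x| * Real.exp (-R) ≤ Real.exp R * (|r| + |k| + N) :=
    (mul_le_mul_of_nonneg_left hEge (abs_nonneg _)).trans h3
  have h7 : Real.exp (-R) * Real.exp R = 1 := by rw [← Real.exp_add]; simp
  calc |w x| = |w x| * Real.exp (-R) * Real.exp R := by rw [mul_assoc, h7, mul_one]
    _ ≤ Real.exp R * (|r| + |k| + N) * Real.exp R := by gcongr
    _ = Real.exp (2 * R) * (|r| + |k| + N) := by rw [two_mul, Real.exp_add]; ring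

/-- The stability constant of periodic linear equations with coefficient bounded by `R`. -/
noncomputable def odeConst (R : ℝ) : ℝ := Real.exp (2 * R) * (2 + 2 * Real.exp (2 * R))

theorem odeConst_pos (R : ℝ) : 0 < odeConst R := by unfold odeConst; positivity

theorem abs_le_odeConst_mul {a g w : ℝ → ℝ} {k R N : ℝ} (ha : Continuous a)
    (hg : Continuous g) (hw : ∀ x, HasDerivAt w (k + g x - a x * w x) x) (hper : w 1 = w 0)
    (hσ : 0 ≤ ∫ x in (0 : ℝ)..1, a x)
    (hR : ∀ x, |a x| ≤ R) (hN : ∀ x, |g x| ≤ N) {x : ℝ} (hx : x ∈ Set.Icc (0 : ℝ) 1) :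
    |w x| ≤ odeConst R * (|∫ x in (0 : ℝ)..1, w x| + N) := by
  refine (abs_le_of_periodic_linear_ode ha hg hw hR hN hx).trans ?_
  have h := abs_const_le_of_periodic_linear_ode ha hg hw hper hσ hR hN
  have hN0 := (abs_nonneg _).trans (hN 0)
  rw [odeConst, mul_assoc]
  gcongr
  have : 0 ≤ 2 * Real.exp (2 * R) * N := by positivity
  linarith [abs_nonneg (∫ x in (0 : ℝ)..1, w x)]

/-! ### The reciprocal Jacobian and solvability of the linear problem -/

theorem hasDerivAt_primitive {f : ℝ → ℝ} (hf : Continuous f) (x : ℝ) :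
    HasDerivAt (fun x => ∫ t in (0 : ℝ)..x, f t) (f x) x :=
  (hf.integral_hasStrictDerivAt 0 x).hasDerivAt

theorem continuous_primitive_zero {f : ℝ → ℝ} (hf : Continuous f) :
    Continuous (fun x => ∫ t in (0 : ℝ)..x, f t) :=
  intervalIntegral.continuous_primitive (fun _ _ => hf.intervalIntegrable _ _) _

/-- The unit square is the union of its two triangles; the proof differentiates the product of the
two primitives. -/
theorem integral_mul_primitive_add {f g : ℝ → ℝ} (hf : Continuous f) (hg : Continuous g) :
    (∫ x in (0 : ℝ)..1, f x * ∫ y in (0 : ℝ)..x, g y) +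
      (∫ x in (0 : ℝ)..1, g x * ∫ y in (0 : ℝ)..x, f y) =
      (∫ x in (0 : ℝ)..1, f x) * ∫ x in (0 : ℝ)..1, g x := by
  have hfG : Continuous fun x => f x * ∫ y in (0 : ℝ)..x, g y :=
    hf.mul (continuous_primitive_zero hg)
  have hgF : Continuous fun x => g x * ∫ y in (0 : ℝ)..x, f y :=
    hg.mul (continuous_primitive_zero hf)
  rw [← intervalIntegral.integral_add (hfG.intervalIntegrable _ _) (hgF.intervalIntegrable _ _),
    intervalIntegral.integral_eq_sub_of_hasDerivAt (f := fun x =>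
      (∫ y in (0 : ℝ)..x, f y) * ∫ y in (0 : ℝ)..x, g y)]
  · simp
  · intro x _
    refine ((hasDerivAt_primitive hf x).mul (hasDerivAt_primitive hg x)).congr_deriv ?_
    ring
  · exact (hfG.add hgF).intervalIntegrable _ _

theorem integral_pos_of_continuous_of_pos {f : ℝ → ℝ} (hf : Continuous f)
    (hpos : ∀ x ∈ Set.Ioo (0 : ℝ) 1, 0 < f x) : 0 < ∫ x in (0 : ℝ)..1, f x :=
  intervalIntegral.intervalIntegral_pos_of_pos_on (hf.intervalIntegrable _ _) hpos zero_lt_one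

theorem primitive_pos {f : ℝ → ℝ} (hf : Continuous f) (hpos : ∀ x, 0 < f x) {x : ℝ}
    (hx : 0 < x) : 0 < ∫ t in (0 : ℝ)..x, f t :=
  intervalIntegral.intervalIntegral_pos_of_pos_on (hf.intervalIntegrable _ _)
    (fun y _ => hpos y) hx

/-- The reciprocal Jacobian as a functional of the path `b = p̃ + s`. -/
noncomputable def jacobianInvOf (b : ℝ → ℝ) : ℝ :=
  1 / (1 - Real.exp (-2 * ∫ t in (0 : ℝ)..1, b t)) *
      (∫ x in (0 : ℝ)..1, ∫ y in (0 : ℝ)..1,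
        Real.exp (2 * ∫ t in (0 : ℝ)..x, b t) * Real.exp (-2 * ∫ t in (0 : ℝ)..y, b t)) -
    ∫ x in (0 : ℝ)..1, ∫ y in (0 : ℝ)..x,
      Real.exp (2 * ∫ t in (0 : ℝ)..x, b t) * Real.exp (-2 * ∫ t in (0 : ℝ)..y, b t)

theorem continuous_exp_mul_primitive {b : ℝ → ℝ} (hb : Continuous b) (c : ℝ) :
    Continuous (fun x => Real.exp (c * ∫ t in (0 : ℝ)..x, b t)) :=
  Real.continuous_exp.comp (continuous_const.mul (continuous_primitive_zero hb))

/-- Since `1 / (1 - e^{-2σ}) = 1 + 1 / (e^{2σ} - 1)`, one copy of the square cancels the subtracted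
triangle and leaves the opposite one. In this form positivity is visible. -/
theorem jacobianInvOf_eq {b : ℝ → ℝ} (hb : Continuous b) (hσ : 0 < ∫ t in (0 : ℝ)..1, b t) :
    jacobianInvOf b =
      (∫ x in (0 : ℝ)..1, Real.exp (2 * ∫ t in (0 : ℝ)..x, b t)) *
        (∫ x in (0 : ℝ)..1, Real.exp (-2 * ∫ t in (0 : ℝ)..x, b t)) /
          (Real.exp (2 * ∫ t in (0 : ℝ)..1, b t) - 1) +
      ∫ x in (0 : ℝ)..1, Real.exp (-2 * ∫ t in (0 : ℝ)..x, b t) *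
        ∫ y in (0 : ℝ)..x, Real.exp (2 * ∫ t in (0 : ℝ)..y, b t) := by
  have htri := integral_mul_primitive_add (continuous_exp_mul_primitive hb 2)
    (continuous_exp_mul_primitive hb (-2))
  simp only [jacobianInvOf, intervalIntegral.integral_const_mul,
    intervalIntegral.integral_mul_const]
  set σ := ∫ t in (0 : ℝ)..1, b t
  have h1 : 0 < Real.exp (2 * σ) - 1 := by
    have := Real.add_one_lt_exp (x := 2 * σ) (by linarith)
    linarith
  have h2 : Real.exp (-2 * σ) = (Real.exp (2 * σ))⁻¹ := by rw [← Real.exp_neg]; ring_nf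
  have h3 : 1 / (1 - Real.exp (-2 * σ)) = 1 + 1 / (Real.exp (2 * σ) - 1) := by
    rw [h2]
    have := Real.exp_pos (2 * σ)
    field_simp
    ring
  rw [h3]
  linear_combination -htri

theorem jacobianInvOf_pos {b : ℝ → ℝ} (hb : Continuous b) (hσ : 0 < ∫ t in (0 : ℝ)..1, b t) :
    0 < jacobianInvOf b := by
  rw [jacobianInvOf_eq hb hσ]
  have h1 : 0 < Real.exp (2 * ∫ t in (0 : ℝ)..1, b t) - 1 := by
    have := Real.add_one_lt_exp (x := 2 * ∫ t in (0 : ℝ)..1, b t) (by linarith)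
    linarith
  have h2 := primitive_pos (continuous_exp_mul_primitive hb 2) (fun x => Real.exp_pos _)
    zero_lt_one
  have h3 := primitive_pos (continuous_exp_mul_primitive hb (-2)) (fun x => Real.exp_pos _)
    zero_lt_one
  have h4 := integral_pos_of_continuous_of_pos ((continuous_exp_mul_primitive hb (-2)).mul
    (continuous_primitive_zero (continuous_exp_mul_primitive hb 2))) fun x hx =>
      mul_pos (Real.exp_pos _) (primitive_pos (continuous_exp_mul_primitive hb 2)
        (fun x => Real.exp_pos _) hx.1)
  positivity

/-- Variation of constants expresses `w` through `w 0` and `k`, and periodicity fixes `w 0` as a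
multiple of `k`. This is the origin of the Jacobian: in the application `k` is the increment of `q₀`
and `∫ w` the increment of `s`. -/
theorem mul_jacobianInvOf {b w : ℝ → ℝ} {k : ℝ} (hb : Continuous b)
    (hσ : 0 < ∫ t in (0 : ℝ)..1, b t) (hw : ∀ x, HasDerivAt w (k - 2 * b x * w x) x)
    (hper : w 1 = w 0) : k * jacobianInvOf b = ∫ x in (0 : ℝ)..1, w x := by
  rw [jacobianInvOf_eq hb hσ]
  have hF := continuous_exp_mul_primitive hb 2
  have hform : ∀ x, w x * Real.exp (2 * ∫ t in (0 : ℝ)..x, b t) =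
      w 0 + k * ∫ y in (0 : ℝ)..x, Real.exp (2 * ∫ t in (0 : ℝ)..y, b t) := by
    intro x
    have h := mul_exp_primitive_eq (a := fun x => 2 * b x) (g := fun _ => 0) (k := k) (w := w)
      (continuous_const.mul hb) continuous_const (fun x => by simpa using hw x) x
    simp only [intervalIntegral.integral_const_mul, intervalIntegral.integral_mul_const,
      add_zero] at h
    rw [h, mul_comm k]
  have hw' : ∀ x, w x = w 0 * Real.exp (-2 * ∫ t in (0 : ℝ)..x, b t) +
      k * (Real.exp (-2 * ∫ t in (0 : ℝ)..x, b t) *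
        ∫ y in (0 : ℝ)..x, Real.exp (2 * ∫ t in (0 : ℝ)..y, b t)) := by
    intro x
    have h1 : Real.exp (2 * ∫ t in (0 : ℝ)..x, b t) * Real.exp (-2 * ∫ t in (0 : ℝ)..x, b t) = 1 := by
      rw [← Real.exp_add]; simp
    linear_combination Real.exp (-2 * ∫ t in (0 : ℝ)..x, b t) * hform x - w x * h1
  have hint : ∫ x in (0 : ℝ)..1, w x =
      w 0 * (∫ x in (0 : ℝ)..1, Real.exp (-2 * ∫ t in (0 : ℝ)..x, b t)) +
      k * ∫ x in (0 : ℝ)..1, (Real.exp (-2 * ∫ t in (0 : ℝ)..x, b t) *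
        ∫ y in (0 : ℝ)..x, Real.exp (2 * ∫ t in (0 : ℝ)..y, b t)) := by
    rw [intervalIntegral.integral_congr (fun x _ => hw' x), intervalIntegral.integral_add,
      intervalIntegral.integral_const_mul, intervalIntegral.integral_const_mul]
    · exact (continuous_const.mul (continuous_exp_mul_primitive hb (-2))).intervalIntegrable _ _
    · exact (continuous_const.mul ((continuous_exp_mul_primitive hb (-2)).mul
        (continuous_primitive_zero hF))).intervalIntegrable _ _
  have h1 : 0 < Real.exp (2 * ∫ t in (0 : ℝ)..1, b t) - 1 := by
    have := Real.add_one_lt_exp (x := 2 * ∫ t in (0 : ℝ)..1, b t) (by linarith)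
    linarith
  have h2 := hform 1
  rw [hper] at h2
  have h3 : w 0 = k * (∫ y in (0 : ℝ)..1, Real.exp (2 * ∫ t in (0 : ℝ)..y, b t)) /
      (Real.exp (2 * ∫ t in (0 : ℝ)..1, b t) - 1) := by
    rw [eq_div_iff h1.ne']; linear_combination h2
  rw [hint, h3]
  ring

/-- Variation of constants leaves the two unknowns `w 0` and `k`, subject to two linear conditions:
equal end values and zero mean. -/
theorem exists_periodic_linear_ode {a g : ℝ → ℝ} (ha : Continuous a) (hg : Continuous g)
    (hpa : Function.Periodic a 1) (hpg : Function.Periodic g 1)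
    (hσ : 0 ≤ ∫ x in (0 : ℝ)..1, a x) :
    ∃ (w : ℝ → ℝ) (k : ℝ), (∀ x, HasDerivAt w (k + g x - a x * w x) x) ∧
      Function.Periodic w 1 ∧ ∫ x in (0 : ℝ)..1, w x = 0 := by
  set A : ℝ → ℝ := fun x => ∫ t in (0 : ℝ)..x, a t with hA
  have hAd : ∀ x, HasDerivAt A (a x) x := hasDerivAt_primitive ha
  have hAc : Continuous A := continuous_primitive_zero ha
  have hE : Continuous fun x => Real.exp (A x) := Real.continuous_exp.comp hAc
  have hE' : Continuous fun x => Real.exp (-A x) := Real.continuous_exp.comp hAc.neg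
  set F : ℝ → ℝ := fun x => ∫ t in (0 : ℝ)..x, Real.exp (A t) with hF
  have hFd : ∀ x, HasDerivAt F (Real.exp (A x)) x := hasDerivAt_primitive hE
  have hFc : Continuous F := continuous_primitive_zero hE
  set H : ℝ → ℝ := fun x => ∫ t in (0 : ℝ)..x, Real.exp (A t) * g t with hH
  have hHd : ∀ x, HasDerivAt H (Real.exp (A x) * g x) x := hasDerivAt_primitive (hE.mul hg)
  have hHc : Continuous H := continuous_primitive_zero (hE.mul hg)
  set G1 := ∫ x in (0 : ℝ)..1, Real.exp (-A x) with hG1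
  set T := ∫ x in (0 : ℝ)..1, Real.exp (-A x) * F x with hT
  set U := ∫ x in (0 : ℝ)..1, Real.exp (-A x) * H x with hU
  have hG1p : 0 < G1 := primitive_pos hE' (fun _ => Real.exp_pos _) zero_lt_one
  have hF1p : 0 < F 1 := primitive_pos hE (fun _ => Real.exp_pos _) zero_lt_one
  have hTp : 0 < T := integral_pos_of_continuous_of_pos (hE'.mul hFc) fun x hx =>
    mul_pos (Real.exp_pos _) (primitive_pos hE (fun _ => Real.exp_pos _) hx.1)
  have hE1 : 0 ≤ Real.exp (A 1) - 1 := sub_nonneg.2 (Real.one_le_exp hσ)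
  -- Up to sign, the determinant of the system for `w0` and `k`. It is positive even when `∫ a = 0`,
  -- thanks to the second term; `w0` and `k` are then given by Cramer's rule.
  set D := (Real.exp (A 1) - 1) * T + F 1 * G1 with hD
  have hDp : 0 < D := by positivity
  set w0 := (H 1 * T - F 1 * U) / D with hw0
  set k := (-(Real.exp (A 1) - 1) * U - G1 * H 1) / D with hk
  have heq1 : (Real.exp (A 1) - 1) * w0 - F 1 * k = H 1 := by
    rw [hw0, hk]; field_simp; rw [hD]; ring
  have heq2 : G1 * w0 + T * k = -U := by
    rw [hw0, hk]; field_simp; rw [hD]; ring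
  set w : ℝ → ℝ := fun x => Real.exp (-A x) * (w0 + k * F x + H x) with hw
  have hinv : ∀ x, Real.exp (-A x) * Real.exp (A x) = 1 := fun x => by
    rw [← Real.exp_add]; simp
  have hwd : ∀ x, HasDerivAt w (k + g x - a x * w x) x := by
    intro x
    refine ((hAd x).neg.exp.mul ((((hFd x).const_mul k).const_add w0).add (hHd x))).congr_deriv ?_
    simp only [hw, Pi.add_apply]
    linear_combination (k + g x) * hinv x
  have hA0 : A 0 = 0 := by simp [hA]
  have hF0 : F 0 = 0 := by simp [hF]
  have hH0 : H 0 = 0 := by simp [hH]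
  have hw00 : w 0 = w0 := by simp [hw, hA0, hF0, hH0]
  have hw1 : w 1 = w0 := by
    have h1 : w0 + k * F 1 + H 1 = Real.exp (A 1) * w0 := by linear_combination -heq1
    simp only [hw]
    rw [h1, ← mul_assoc, hinv, one_mul]
  have hperiodic : Function.Periodic w 1 := by
    -- The increment over a period solves the homogeneous equation and vanishes at `0`, hence
    -- everywhere.
    set v : ℝ → ℝ := fun x => w (x + 1) - w x with hv
    have hvd : ∀ x, HasDerivAt v (0 + 0 - a x * v x) x := by
      intro x
      have h1 : HasDerivAt (fun x => w (x + 1)) (k + g x - a x * w (x + 1)) x := by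
        have := (hwd (x + 1)).comp_add_const x 1
        rwa [hpa x, hpg x] at this
      refine (h1.sub (hwd x)).congr_deriv ?_
      simp only [hv]; ring
    intro x
    have h := mul_exp_primitive_eq ha (continuous_const (y := (0 : ℝ))) hvd x
    have h0 : v 0 = 0 := by simp [hv, hw1, hw00]
    rw [h0] at h
    have hvx : v x = 0 := by
      simp only [add_zero, mul_zero, intervalIntegral.integral_zero, mul_eq_zero,
        Real.exp_ne_zero, or_false] at h
      exact h
    exact sub_eq_zero.1 hvx
  refine ⟨w, k, hwd, hperiodic, ?_⟩
  have hsplit : ∫ x in (0 : ℝ)..1, w x = ∫ x in (0 : ℝ)..1,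
      ((w0 * Real.exp (-A x) + k * (Real.exp (-A x) * F x)) + Real.exp (-A x) * H x) :=
    intervalIntegral.integral_congr fun x _ => by simp only [hw]; ring
  rw [hsplit, intervalIntegral.integral_add, intervalIntegral.integral_add,
    intervalIntegral.integral_const_mul, intervalIntegral.integral_const_mul]
  · linear_combination heq2
  · exact (continuous_const.mul hE').intervalIntegrable _ _
  · exact (continuous_const.mul (hE'.mul hFc)).intervalIntegrable _ _
  · exact ((continuous_const.mul hE').add (continuous_const.mul (hE'.mul hFc))).intervalIntegrable _ _
  · exact (hE'.mul hHc).intervalIntegrable _ _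

/-! ### Functions on the circle -/

theorem continuous_coe_circle (f : C(UnitAddCircle, ℝ)) :
    Continuous fun x : ℝ => f (x : UnitAddCircle) :=
  f.continuous.comp (AddCircle.continuous_mk' 1)

theorem periodic_coe_circle (f : C(UnitAddCircle, ℝ)) :
    Function.Periodic (fun x : ℝ => f (x : UnitAddCircle)) 1 := fun x => by
  simp

/-- A continuous `1`-periodic function as a function on the circle. -/
noncomputable def circleLift (f : ℝ → ℝ) (hf : Continuous f) (hp : Function.Periodic f 1) :
    C(UnitAddCircle, ℝ) :=
  ⟨hp.lift, continuous_coinduced_dom.2 hf⟩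

theorem circle_ext {u v : C(UnitAddCircle, ℝ)}
    (h : ∀ x : ℝ, u (x : UnitAddCircle) = v (x : UnitAddCircle)) : u = v :=
  ContinuousMap.ext fun x => QuotientAddGroup.induction_on x h

theorem circle_norm_le {u : C(UnitAddCircle, ℝ)} {M : ℝ}
    (h : ∀ x ∈ Set.Icc (0 : ℝ) 1, |u (x : UnitAddCircle)| ≤ M) : ‖u‖ ≤ M := by
  have hM : 0 ≤ M := (abs_nonneg _).trans (h 0 (by simp))
  refine (u.norm_le hM).2 fun x => ?_
  refine QuotientAddGroup.induction_on x fun y => ?_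
  obtain ⟨z, hz, hyz⟩ := (periodic_coe_circle u).exists_mem_Ico₀ zero_lt_one y
  exact (congrArg abs hyz).le.trans (h z ⟨hz.1, hz.2.le⟩)

theorem abs_coe_le_norm (u : C(UnitAddCircle, ℝ)) (x : UnitAddCircle) : |u x| ≤ ‖u‖ :=
  u.norm_coe_le_norm x

/-- The mean of a function on the circle. -/
noncomputable def circleMean : C(UnitAddCircle, ℝ) →L[ℝ] ℝ :=
  LinearMap.mkContinuous
    { toFun := fun f => ∫ x in (0 : ℝ)..1, f (x : UnitAddCircle)
      map_add' := fun f g => intervalIntegral.integral_add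
        ((continuous_coe_circle f).intervalIntegrable _ _)
        ((continuous_coe_circle g).intervalIntegrable _ _)
      map_smul' := fun c f => intervalIntegral.integral_const_mul _ _ } 1 fun f => by
    simpa using abs_primitive_le (fun x : ℝ => abs_coe_le_norm f (x : UnitAddCircle))
      zero_le_one le_rfl

theorem circleMean_apply (f : C(UnitAddCircle, ℝ)) :
    circleMean f = ∫ x in (0 : ℝ)..1, f (x : UnitAddCircle) := rfl

theorem circleMean_eq_integral (f : C(UnitAddCircle, ℝ)) : circleMean f = ∫ x, f x := by
  rw [circleMean_apply, ← UnitAddCircle.intervalIntegral_preimage 0, zero_add]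

theorem circleMean_one : circleMean 1 = 1 := by simp [circleMean_apply]

theorem abs_circleMean_le (f : C(UnitAddCircle, ℝ)) : |circleMean f| ≤ ‖f‖ := by
  simpa [circleMean_apply] using abs_primitive_le (fun x : ℝ => abs_coe_le_norm f (x : UnitAddCircle))
      zero_le_one le_rfl

/-- The projection of functions on the circle onto those of mean zero. -/
noncomputable def meanFree : C(UnitAddCircle, ℝ) →L[ℝ] C(UnitAddCircle, ℝ) :=
  ContinuousLinearMap.id ℝ _ - circleMean.smulRight 1

theorem meanFree_apply (f : C(UnitAddCircle, ℝ)) (x : UnitAddCircle) :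
    meanFree f x = f x - circleMean f := by
  simp [meanFree]

theorem circleMean_meanFree (f : C(UnitAddCircle, ℝ)) : circleMean (meanFree f) = 0 := by
  simp [meanFree, circleMean_one]

theorem meanZeroPart_apply (f : C(UnitAddCircle, ℝ)) (x : UnitAddCircle) :
    (meanZeroPart f).1 x = f x - circleMean f := by
  rw [circleMean_eq_integral]; rfl

theorem meanZeroPart_coe (f : C(UnitAddCircle, ℝ)) : (meanZeroPart f).1 = meanFree f :=
  ContinuousMap.ext fun x => by rw [meanZeroPart_apply, meanFree_apply]

theorem eq_of_hasDerivAt_of_circleMean {u v : C(UnitAddCircle, ℝ)} {f : ℝ → ℝ}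
    (hu : ∀ x : ℝ, HasDerivAt (fun x : ℝ => u (x : UnitAddCircle)) (f x) x)
    (hv : ∀ x : ℝ, HasDerivAt (fun x : ℝ => v (x : UnitAddCircle)) (f x) x)
    (h : circleMean u = circleMean v) : u = v := by
  have hc : ∀ x y : ℝ, (u - v) (x : UnitAddCircle) = (u - v) (y : UnitAddCircle) :=
    is_const_of_deriv_eq_zero (f := fun x : ℝ => (u - v) (x : UnitAddCircle))
      (fun x => ((hu x).sub (hv x)).differentiableAt)
      fun x => by simpa [Pi.sub_def] using ((hu x).sub (hv x)).deriv
  have h0 : (u - v) ((0 : ℝ) : UnitAddCircle) = 0 := by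
    have h1 : circleMean (u - v) = (u - v) ((0 : ℝ) : UnitAddCircle) := by
      rw [circleMean_apply, intervalIntegral.integral_congr fun x _ => hc x 0]
      simp
    rw [← h1, map_sub, h, sub_self]
  exact circle_ext fun x => sub_eq_zero.1 ((hc x 0).trans h0)

/-- This is the linear problem with `a = 0`; integrating over a period forces `k = -circleMean f`.
-/
theorem exists_circlePrimitive (f : C(UnitAddCircle, ℝ)) :
    ∃ u : C(UnitAddCircle, ℝ),
      (∀ x : ℝ, HasDerivAt (fun x : ℝ => u (x : UnitAddCircle))
        (f (x : UnitAddCircle) - circleMean f) x) ∧ circleMean u = 0 := by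
  have hfc := continuous_coe_circle f
  obtain ⟨w, k, hw, hper, hmean⟩ := exists_periodic_linear_ode (a := fun _ => 0)
    continuous_const hfc (fun _ => rfl) (periodic_coe_circle f) (by simp)
  have hwc : Continuous w := continuous_iff_continuousAt.2 fun x => (hw x).continuousAt
  have hk : k = -circleMean f := by
    have h := intervalIntegral.integral_eq_sub_of_hasDerivAt (a := 0) (b := 1)
      (fun x _ => (hw x)) (Continuous.intervalIntegrable (by fun_prop) _ _)
    have h1 : w 1 = w 0 := by simpa using hper 0
    simp only [zero_mul, sub_zero, h1, sub_self] at h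
    rw [intervalIntegral.integral_add (by simp) (hfc.intervalIntegrable _ _)] at h
    simp only [intervalIntegral.integral_const, sub_zero, one_smul] at h
    rw [circleMean_apply]; linarith
  refine ⟨circleLift w hwc hper, fun x => ?_, hmean⟩
  exact (hw x).congr_deriv (by rw [hk]; ring)

/-- The periodic mean-zero primitive of the mean-zero part of `f`. -/
noncomputable def circlePrimitive : C(UnitAddCircle, ℝ) →L[ℝ] C(UnitAddCircle, ℝ) :=
  LinearMap.mkContinuous
    { toFun := fun f => (exists_circlePrimitive f).choose
      map_add' := fun f g => by
        have hf := (exists_circlePrimitive f).choose_spec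
        have hg := (exists_circlePrimitive g).choose_spec
        have hfg := (exists_circlePrimitive (f + g)).choose_spec
        refine eq_of_hasDerivAt_of_circleMean hfg.1 (fun x => ?_)
          (by rw [hfg.2, map_add, hf.2, hg.2, add_zero])
        refine ((hf.1 x).add (hg.1 x)).congr_deriv ?_
        rw [map_add, ContinuousMap.add_apply]; ring
      map_smul' := fun c f => by
        have hf := (exists_circlePrimitive f).choose_spec
        have hcf := (exists_circlePrimitive (c • f)).choose_spec
        refine eq_of_hasDerivAt_of_circleMean hcf.1 (fun x => ?_)
          (by rw [hcf.2, RingHom.id_apply, map_smul, hf.2, smul_zero])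
        refine ((hf.1 x).const_mul c).congr_deriv ?_
        simp only [map_smul, ContinuousMap.smul_apply, smul_eq_mul]; ring } 2 fun f => by
    have hf := (exists_circlePrimitive f).choose_spec
    refine circle_norm_le fun x hx => ?_
    have h := abs_le_of_periodic_linear_ode (a := fun _ => 0) (R := 0) (k := 0)
      (g := fun x : ℝ => f (x : UnitAddCircle) - circleMean f) (N := 2 * ‖f‖) continuous_const
      ((continuous_coe_circle f).sub continuous_const)
      (fun x => (hf.1 x).congr_deriv (by ring)) (by simp) (fun x => ?_) hx
    · rw [← circleMean_apply, hf.2] at h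
      simpa using h
    · refine (abs_sub _ _).trans ?_
      linarith [abs_coe_le_norm f (x : UnitAddCircle), abs_circleMean_le f]

theorem hasDerivAt_circlePrimitive (f : C(UnitAddCircle, ℝ)) (x : ℝ) :
    HasDerivAt (fun x : ℝ => circlePrimitive f (x : UnitAddCircle))
      (f (x : UnitAddCircle) - circleMean f) x :=
  (exists_circlePrimitive f).choose_spec.1 x

theorem circleMean_circlePrimitive (f : C(UnitAddCircle, ℝ)) :
    circleMean (circlePrimitive f) = 0 :=
  (exists_circlePrimitive f).choose_spec.2

theorem circlePrimitive_eq {f u : C(UnitAddCircle, ℝ)}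
    (hu : ∀ x : ℝ, HasDerivAt (fun x : ℝ => u (x : UnitAddCircle))
      (f (x : UnitAddCircle) - circleMean f) x) (h : circleMean u = 0) :
    circlePrimitive f = u :=
  eq_of_hasDerivAt_of_circleMean (hasDerivAt_circlePrimitive f) hu
    (by rw [circleMean_circlePrimitive, h])

/-! ### A priori estimates for Riccati's equation -/

theorem exists_forall_le_of_periodic {f : ℝ → ℝ} (hf : Continuous f) (hp : Function.Periodic f 1) :
    ∃ x, ∀ y, f y ≤ f x := by
  obtain ⟨x, -, hx⟩ := isCompact_Icc.exists_isMaxOn (Set.nonempty_Icc.2 (zero_le_one (α := ℝ)))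
    hf.continuousOn
  refine ⟨x, fun y => ?_⟩
  obtain ⟨z, hz, hyz⟩ := hp.exists_mem_Ico₀ zero_lt_one y
  exact hyz.le.trans (hx ⟨hz.1, hz.2.le⟩)

namespace IsRiccatiSolution

variable {s : ℝ} {qt : MeanZeroPath} {p : ℝ → ℝ}

theorem continuous (h : IsRiccatiSolution s qt p) : Continuous p :=
  continuous_iff_continuousAt.2 fun x => (h.ode x).continuousAt

theorem integral_add_const (h : IsRiccatiSolution s qt p) (t : ℝ) :
    ∫ x in (0 : ℝ)..1, (p x + t) = t := by
  rw [intervalIntegral.integral_add (h.continuous.intervalIntegrable _ _) (by simp), h.mean_zero]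
  simp

/-- The primitive `Q` of `p` is periodic. At its maximum `p = 0` and `p' ≤ 0`, while the equation
there reads `p' = q̃ + ∫ p²`. The bound does not depend on `s`. -/
theorem integral_sq_le (h : IsRiccatiSolution s qt p) {N : ℝ} (hN : ∀ x, |qt.1 x| ≤ N) :
    ∫ x in (0 : ℝ)..1, p x ^ 2 ≤ N := by
  set Q : ℝ → ℝ := fun x => ∫ t in (0 : ℝ)..x, p t with hQ
  have hQd : ∀ x, HasDerivAt Q (p x) x := hasDerivAt_primitive h.continuous
  have hQc : Continuous Q := continuous_primitive_zero h.continuous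
  have hQp : Function.Periodic Q 1 := fun x => by
    have h1 := h.periodic.intervalIntegral_add_eq x 0
    rw [zero_add, h.mean_zero] at h1
    have h2 := intervalIntegral.integral_add_adjacent_intervals
      (h.continuous.intervalIntegrable (μ := volume) 0 x)
      (h.continuous.intervalIntegrable (μ := volume) x (x + 1))
    simp only [hQ]
    rw [← h2, h1, add_zero]
  obtain ⟨x, hx⟩ := exists_forall_le_of_periodic hQc hQp
  have hmax : IsLocalMax Q x := Filter.Eventually.of_forall hx
  have hpx : p x = 0 := hmax.hasDerivAt_eq_zero (hQd x)
  by_contra! hlt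
  have hderiv : deriv Q = p := funext fun x => (hQd x).deriv
  have hpos : 0 < deriv (deriv Q) x := by
    rw [hderiv, (h.ode x).deriv, hpx]
    have := (abs_le.1 (hN (x : UnitAddCircle))).1
    norm_num
    linarith
  -- A maximum that is also a local minimum makes `Q` locally constant, against the positive second
  -- derivative.
  have hmin := isLocalMin_of_deriv_deriv_pos hpos (by rw [hderiv, hpx]) hQc.continuousAt
  have hconst : Q =ᶠ[nhds x] fun _ => Q x := by
    filter_upwards [hmin] with y hy using le_antisymm (hx y) hy
  have h0 : deriv (deriv Q) x = 0 := by
    rw [hconst.deriv.deriv_eq]; simp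
  exact hpos.ne' h0

/-- At a critical point, completing the square gives `(p + s)² = q̃ + ∫ p² + s² ≤ 2N + s²`. The
extrema of the periodic function `p` are such points. -/
theorem abs_apply_le (h : IsRiccatiSolution s qt p) {N : ℝ} (hN : ∀ x, |qt.1 x| ≤ N) (x : ℝ) :
    |p x| ≤ 2 * |s| + N + 1 := by
  have hcrit : ∀ y, HasDerivAt p 0 y → |p y| ≤ 2 * |s| + N + 1 := by
    intro y hy
    have h1 := hy.unique (h.ode y)
    have h2 := h.integral_sq_le hN
    have h3 := (abs_le.1 (hN (y : UnitAddCircle))).2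
    have hN0 := (abs_nonneg _).trans (hN 0)
    have h4 : |p y + s| ≤ |s| + N + 1 := by
      refine abs_le_of_sq_le_sq ?_ (by positivity)
      nlinarith [sq_abs s, mul_nonneg (abs_nonneg s) hN0, abs_nonneg s, sq_nonneg N]
    have h5 := abs_sub (p y + s) s
    rw [add_sub_cancel_right] at h5
    linarith
  obtain ⟨y, hy⟩ := exists_forall_le_of_periodic h.continuous h.periodic
  obtain ⟨z, hz⟩ := exists_forall_le_of_periodic h.continuous.neg (fun x => congrArg Neg.neg (h.periodic x))
  have hy' : IsLocalMax p y := Filter.Eventually.of_forall hy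
  have hz' : IsLocalMin p z := Filter.Eventually.of_forall fun t => neg_le_neg_iff.1 (hz t)
  have hy0 : HasDerivAt p 0 y := (h.ode y).congr_deriv (hy'.hasDerivAt_eq_zero (h.ode y))
  have hz0 : HasDerivAt p 0 z := (h.ode z).congr_deriv (hz'.hasDerivAt_eq_zero (h.ode z))
  exact abs_le.2 ⟨(abs_le.1 (hcrit z hz0)).1.trans (neg_le_neg_iff.1 (hz x)),
    (hy x).trans (abs_le.1 (hcrit y hy0)).2⟩

/-- Factoring the difference of squares makes this linear equation exact, with no remainder.
Uniqueness, continuity and differentiability in the parameters all come from it. -/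
theorem hasDerivAt_sub {s₁ s₂ : ℝ} {q₁ q₂ : MeanZeroPath} {p₁ p₂ : ℝ → ℝ}
    (h₁ : IsRiccatiSolution s₁ q₁ p₁) (h₂ : IsRiccatiSolution s₂ q₂ p₂) (x : ℝ) :
    HasDerivAt (fun x => (p₁ x + s₁) - (p₂ x + s₂))
      ((((∫ y in (0 : ℝ)..1, p₁ y ^ 2) + s₁ ^ 2) - ((∫ y in (0 : ℝ)..1, p₂ y ^ 2) + s₂ ^ 2)) +
        (q₁.1 (x : UnitAddCircle) - q₂.1 (x : UnitAddCircle)) -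
        ((p₁ x + s₁) + (p₂ x + s₂)) * ((p₁ x + s₁) - (p₂ x + s₂))) x := by
  refine (((h₁.ode x).add_const s₁).sub ((h₂.ode x).add_const s₂)).congr_deriv ?_
  ring

theorem abs_sub_le {s₁ s₂ R N : ℝ} {q₁ q₂ : MeanZeroPath} {p₁ p₂ : ℝ → ℝ} (hs₁ : 0 ≤ s₁)
    (hs₂ : 0 ≤ s₂) (h₁ : IsRiccatiSolution s₁ q₁ p₁) (h₂ : IsRiccatiSolution s₂ q₂ p₂)
    (hR₁ : ∀ x, |p₁ x + s₁| ≤ R) (hR₂ : ∀ x, |p₂ x + s₂| ≤ R) (hN : ∀ x, |q₁.1 x - q₂.1 x| ≤ N)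
    {x : ℝ} (hx : x ∈ Set.Icc (0 : ℝ) 1) :
    |(p₁ x + s₁) - (p₂ x + s₂)| ≤ odeConst (2 * R) * (|s₁ - s₂| + N) := by
  have hc₁ := h₁.continuous
  have hc₂ := h₂.continuous
  have hi₁ := h₁.integral_add_const s₁
  have hi₂ := h₂.integral_add_const s₂
  have h := abs_le_odeConst_mul (R := 2 * R) (N := N) (a := fun x => (p₁ x + s₁) + (p₂ x + s₂))
    (by fun_prop) ((continuous_coe_circle q₁.1).sub (continuous_coe_circle q₂.1))
    (hasDerivAt_sub h₁ h₂)
    (by have := h₁.periodic 0; have := h₂.periodic 0; simp_all)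
    (by
      rw [intervalIntegral.integral_add (Continuous.intervalIntegrable (by fun_prop) _ _)
        (Continuous.intervalIntegrable (by fun_prop) _ _), hi₁, hi₂]
      positivity)
    (fun x => (abs_add_le _ _).trans (by linarith [hR₁ x, hR₂ x])) (fun x => hN x) hx
  rwa [intervalIntegral.integral_sub (Continuous.intervalIntegrable (by fun_prop) _ _)
        (Continuous.intervalIntegrable (by fun_prop) _ _), hi₁, hi₂] at h

end IsRiccatiSolution

/-! ### Existence and uniqueness for Riccati's equation -/

/-- Riccati's equation as a nonlinear operator on the derivative `φ` of the unknown path. -/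
noncomputable def riccatiOp (s : ℝ) (φ : C(UnitAddCircle, ℝ)) : C(UnitAddCircle, ℝ) :=
  φ + meanFree (circlePrimitive φ * circlePrimitive φ + (2 * s) • circlePrimitive φ)

/-- `riccatiOp` acts on all continuous functions, not only those of mean zero: it preserves the
mean, and `circlePrimitive` ignores it. So it suffices to solve `riccatiOp s φ = q̃` in the full
Banach space. -/
theorem isRiccatiSolution_circlePrimitive (s : ℝ) (φ : C(UnitAddCircle, ℝ)) :
    IsRiccatiSolution s (meanZeroPart (riccatiOp s φ))
      (fun x : ℝ => circlePrimitive φ (x : UnitAddCircle)) where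
  periodic := periodic_coe_circle _
  mean_zero := circleMean_circlePrimitive φ
  ode x := by
    refine (hasDerivAt_circlePrimitive φ x).congr_deriv ?_
    have h1 : circleMean (circlePrimitive φ * circlePrimitive φ) =
        ∫ y in (0 : ℝ)..1, circlePrimitive φ (y : UnitAddCircle) ^ 2 := by
      rw [circleMean_apply]
      exact intervalIntegral.integral_congr fun y _ => (sq _).symm
    have h2 : circleMean (riccatiOp s φ) = circleMean φ := by
      rw [riccatiOp, map_add, circleMean_meanFree, add_zero]
    rw [meanZeroPart_apply, h2, ← h1]
    simp only [riccatiOp, ContinuousMap.add_apply, meanFree_apply, ContinuousMap.mul_apply,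
      ContinuousMap.smul_apply, smul_eq_mul, map_add, map_smul, circleMean_circlePrimitive]
    ring

theorem hasStrictFDerivAt_riccatiOp (s : ℝ) (φ : C(UnitAddCircle, ℝ)) :
    HasStrictFDerivAt (riccatiOp s)
      (ContinuousLinearMap.id ℝ _ + meanFree.comp
        ((circlePrimitive φ • circlePrimitive + circlePrimitive φ • circlePrimitive) +
          (2 * s) • circlePrimitive)) φ := by
  have h := circlePrimitive.hasStrictFDerivAt (x := φ)
  exact (hasStrictFDerivAt_id φ).add
    (meanFree.hasStrictFDerivAt.comp φ ((h.mul h).add (h.const_smul (2 * s))))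

theorem continuous_riccatiOp (s : ℝ) : Continuous (riccatiOp s) :=
  continuous_iff_continuousAt.2 fun φ => (hasStrictFDerivAt_riccatiOp s φ).hasFDerivAt.continuousAt

/-- The primitive `w` of `ψ` must solve `w' = k + g - 2 (u + s) w` with mean zero, where `u` is the
primitive of `φ`. This is the periodic linear problem, since the coefficient has mean `2 s ≥ 0`. -/
theorem exists_linearized_riccatiOp {s : ℝ} (hs : 0 ≤ s) (φ g : C(UnitAddCircle, ℝ)) :
    ∃ ψ : C(UnitAddCircle, ℝ), ψ + meanFree
      ((circlePrimitive φ * circlePrimitive ψ + circlePrimitive φ * circlePrimitive ψ) +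
        (2 * s) • circlePrimitive ψ) = g := by
  set u := circlePrimitive φ with hu
  have huc := continuous_coe_circle u
  have hgc := continuous_coe_circle g
  have hu0 : ∫ x in (0 : ℝ)..1, u (x : UnitAddCircle) = 0 := circleMean_circlePrimitive φ
  obtain ⟨w, k, hw, hper, hmean⟩ := exists_periodic_linear_ode
    (a := fun x : ℝ => 2 * (u (x : UnitAddCircle) + s)) (g := fun x : ℝ => g (x : UnitAddCircle))
    (by fun_prop) hgc (fun x => by simp) (periodic_coe_circle g) (by
      rw [intervalIntegral.integral_const_mul,
        intervalIntegral.integral_add (huc.intervalIntegrable _ _) (by simp), hu0]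
      simpa using hs)
  have hwc : Continuous w := continuous_iff_continuousAt.2 fun x => (hw x).continuousAt
  set W := circleLift w hwc hper with hW
  have hWmean : circleMean W = 0 := hmean
  have hWw : ∀ x : ℝ, W (x : UnitAddCircle) = w x := fun x => rfl
  set ψ : C(UnitAddCircle, ℝ) := g - meanFree ((u * W + u * W) + (2 * s) • W) with hψ
  have hk : k = circleMean ((u * W + u * W) + (2 * s) • W) - circleMean g := by
    have h := intervalIntegral.integral_eq_sub_of_hasDerivAt (a := 0) (b := 1)
      (fun x _ => (hw x)) (Continuous.intervalIntegrable (by fun_prop) _ _)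
    have h1 : w 1 = w 0 := by simpa using hper 0
    rw [h1, sub_self] at h
    have h2 : circleMean (k • (1 : C(UnitAddCircle, ℝ)) + g - ((u * W + u * W) + (2 * s) • W)) = 0 := by
      refine (intervalIntegral.integral_congr fun x _ => ?_).trans h
      simp only [ContinuousMap.sub_apply, ContinuousMap.add_apply, ContinuousMap.smul_apply,
        ContinuousMap.mul_apply, ContinuousMap.one_apply, smul_eq_mul, hWw]
      ring
    rw [map_sub, map_add, map_smul, circleMean_one, smul_eq_mul, mul_one] at h2
    linarith
  have hI : circlePrimitive ψ = W := by
    refine circlePrimitive_eq (fun x => (hw x).congr_deriv ?_) hWmean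
    rw [hk, hψ, map_sub, circleMean_meanFree]
    simp only [ContinuousMap.sub_apply, ContinuousMap.add_apply, ContinuousMap.smul_apply,
      ContinuousMap.mul_apply, smul_eq_mul, hWw, meanFree_apply]
    ring
  exact ⟨ψ, by rw [hI, hψ, sub_add_cancel]⟩

/-- The strict derivative is onto at every point, so the operator maps neighbourhoods onto
neighbourhoods. -/
theorem isOpen_range_riccatiOp {s : ℝ} (hs : 0 ≤ s) : IsOpen (Set.range (riccatiOp s)) := by
  rw [isOpen_iff_mem_nhds]
  rintro _ ⟨φ, rfl⟩
  rw [← (hasStrictFDerivAt_riccatiOp s φ).map_nhds_eq_of_surj]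
  · exact Filter.range_mem_map
  · refine LinearMap.range_eq_top.2 fun g => ?_
    obtain ⟨ψ, hψ⟩ := exists_linearized_riccatiOp hs φ g
    exact ⟨ψ, hψ⟩

theorem abs_meanZeroPart_le (f : C(UnitAddCircle, ℝ)) (x : UnitAddCircle) :
    |(meanZeroPart f).1 x| ≤ 2 * ‖f‖ := by
  rw [meanZeroPart_apply]
  refine (abs_sub _ _).trans ?_
  linarith [abs_coe_le_norm f x, abs_circleMean_le f]

/-- For convergent data the a priori bound controls the paths uniformly, and the difference estimate
then makes them a Cauchy sequence. -/
theorem isClosed_range_riccatiOp {s : ℝ} (hs : 0 ≤ s) : IsClosed (Set.range (riccatiOp s)) := by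
  refine isSeqClosed_iff_isClosed.1 fun g g₀ hg hlim => ?_
  choose φ hφ using hg
  obtain ⟨B, hB⟩ : ∃ B, ∀ n, ‖g n‖ ≤ B := by
    obtain ⟨B, hB⟩ := hlim.norm.bddAbove_range
    exact ⟨B, fun n => hB ⟨n, rfl⟩⟩
  set u := fun n => circlePrimitive (φ n) with hu
  have hsol : ∀ n, IsRiccatiSolution s (meanZeroPart (g n))
      (fun x : ℝ => u n (x : UnitAddCircle)) := fun n => by
    rw [← hφ n]; exact isRiccatiSolution_circlePrimitive s (φ n)
  have hR : ∀ n (x : ℝ), |u n (x : UnitAddCircle) + s| ≤ 3 * s + 2 * B + 1 := fun n x => by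
    have h := (hsol n).abs_apply_le (N := 2 * B)
      (fun x => (abs_meanZeroPart_le _ x).trans (by linarith [hB n])) x
    refine (abs_add_le _ _).trans ?_
    rw [abs_of_nonneg hs] at h ⊢
    linarith
  set c := odeConst (2 * (3 * s + 2 * B + 1))
  have hc : 0 < c := odeConst_pos _
  have hdist : ∀ n m, dist (u n) (u m) ≤ 2 * c * dist (g n) (g m) := fun n m => by
    rw [dist_eq_norm, dist_eq_norm]
    refine circle_norm_le fun x hx => ?_
    have h := IsRiccatiSolution.abs_sub_le hs hs (hsol n) (hsol m) (hR n) (hR m)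
      (N := 2 * ‖g n - g m‖) (fun x => by
        have := abs_meanZeroPart_le (g n - g m) x
        rwa [meanZeroPart_coe, map_sub, ← meanZeroPart_coe, ← meanZeroPart_coe] at this) hx
    rw [sub_self, abs_zero, zero_add, add_sub_add_right_eq_sub] at h
    rw [ContinuousMap.sub_apply]
    linarith
  have hcau : CauchySeq u := by
    refine Metric.cauchySeq_iff.2 fun ε hε => ?_
    obtain ⟨n₀, hn₀⟩ := Metric.cauchySeq_iff.1 hlim.cauchySeq (ε / (2 * c)) (by positivity)
    refine ⟨n₀, fun m hm n hn => (hdist m n).trans_lt ?_⟩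
    have := hn₀ m hm n hn
    rwa [lt_div_iff₀' (by positivity)] at this
  obtain ⟨u₀, hu₀⟩ := cauchySeq_tendsto_of_complete hcau
  -- The equation itself expresses the derivative `φ n` through `g n` and `u n`, so convergence of
  -- the primitives passes to `φ n`.
  have hφlim : Tendsto φ atTop (𝓝 (g₀ - meanFree (u₀ * u₀ + (2 * s) • u₀))) := by
    have h : φ = fun n => g n - meanFree (u n * u n + (2 * s) • u n) := funext fun n => by
      rw [← hφ n, riccatiOp, add_sub_cancel_right]
    rw [h]
    exact hlim.sub ((meanFree.continuous.tendsto _).comp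
      ((hu₀.mul hu₀).add (hu₀.const_smul (2 * s))))
  refine ⟨_, tendsto_nhds_unique (((continuous_riccatiOp s).tendsto _).comp hφlim) ?_⟩
  exact hlim.congr fun n => (hφ n).symm

theorem surjective_riccatiOp {s : ℝ} (hs : 0 ≤ s) : Function.Surjective (riccatiOp s) :=
  Set.range_eq_univ.1 (IsClopen.eq_univ ⟨isClosed_range_riccatiOp hs, isOpen_range_riccatiOp hs⟩
    (Set.range_nonempty _))

theorem meanZeroPart_coe_self (qt : MeanZeroPath) : meanZeroPart qt.1 = qt :=
  Subtype.ext <| ContinuousMap.ext fun x => by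
    rw [meanZeroPart_apply, circleMean_eq_integral, qt.2, sub_zero]

theorem exists_isRiccatiSolution {s : ℝ} (hs : 0 ≤ s) (qt : MeanZeroPath) :
    ∃ p, IsRiccatiSolution s qt p := by
  obtain ⟨φ, hφ⟩ := surjective_riccatiOp hs qt.1
  have h := isRiccatiSolution_circlePrimitive s φ
  rw [hφ, meanZeroPart_coe_self] at h
  exact ⟨_, h⟩

theorem IsRiccatiSolution.abs_add_le {s : ℝ} (hs : 0 ≤ s) {qt : MeanZeroPath} {p : ℝ → ℝ}
    (h : IsRiccatiSolution s qt p) (x : ℝ) : |p x + s| ≤ 3 * s + ‖qt.1‖ + 1 := by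
  have h1 := h.abs_apply_le (abs_coe_le_norm qt.1) x
  rw [abs_of_nonneg hs] at h1
  have h2 := _root_.abs_add_le (p x) s
  rw [abs_of_nonneg hs] at h2
  linarith

theorem IsRiccatiSolution.unique {s : ℝ} (hs : 0 ≤ s) {qt : MeanZeroPath} {p₁ p₂ : ℝ → ℝ}
    (h₁ : IsRiccatiSolution s qt p₁) (h₂ : IsRiccatiSolution s qt p₂) : p₁ = p₂ := by
  funext x
  have hper : Function.Periodic (fun x => p₁ x - p₂ x) 1 := fun x => by
    simp only [h₁.periodic x, h₂.periodic x]
  obtain ⟨y, hy, hxy⟩ := hper.exists_mem_Ico₀ zero_lt_one x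
  have h := IsRiccatiSolution.abs_sub_le hs hs h₁ h₂ (h₁.abs_add_le hs) (h₂.abs_add_le hs)
    (N := 0) (fun x => by simp) ⟨hy.1, hy.2.le⟩
  rw [sub_self, abs_zero, add_zero, mul_zero, add_sub_add_right_eq_sub] at h
  have h0 : p₁ y - p₂ y = 0 := abs_nonpos_iff.1 h
  exact sub_eq_zero.1 (hxy.trans h0)

theorem isRiccatiSolution_riccati {s : ℝ} (hs : 0 ≤ s) (qt : MeanZeroPath) :
    IsRiccatiSolution s qt (riccati s qt) := by
  have h := exists_isRiccatiSolution hs qt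
  rw [riccati, dif_pos h]
  exact h.choose_spec

theorem existsUnique_isRiccatiSolution {s : ℝ} (hs : 0 ≤ s) (qt : MeanZeroPath) :
    ∃! p : ℝ → ℝ, IsRiccatiSolution s qt p :=
  ⟨_, isRiccatiSolution_riccati hs qt, fun _ h => h.unique hs (isRiccatiSolution_riccati hs qt)⟩

/-! ### Dependence on the parameters -/

/-- The path `p̃ + s` on the circle, at log-multiplier `s⁺`. -/
noncomputable def riccatiPath (z : MeanZeroPath × ℝ) : C(UnitAddCircle, ℝ) :=
  have h := isRiccatiSolution_riccati (le_max_right z.2 0) z.1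
  circleLift (fun x => riccati (max z.2 0) z.1 x + max z.2 0)
    (h.continuous.add continuous_const) fun x => by simp only [h.periodic x]

theorem riccatiPath_coe (z : MeanZeroPath × ℝ) (x : ℝ) :
    riccatiPath z (x : UnitAddCircle) = riccati (max z.2 0) z.1 x + max z.2 0 := rfl

theorem riccatiPath_coe_of_nonneg {s : ℝ} (hs : 0 ≤ s) (qt : MeanZeroPath) (x : ℝ) :
    riccatiPath (qt, s) (x : UnitAddCircle) = riccati s qt x + s := by
  rw [riccatiPath_coe, max_eq_left hs]

theorem continuous_riccatiPath : Continuous riccatiPath := by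
  rw [continuous_iff_continuousAt]
  intro z₀
  rw [ContinuousAt, tendsto_iff_norm_sub_tendsto_zero]
  -- A sup bound common to all paths with parameters near `z₀`, so that one Lipschitz constant
  -- serves the neighbourhood.
  set R := 3 * (max z₀.2 0 + 1) + (‖z₀.1.1‖ + 1) + 1 with hR
  have hcs : Continuous fun z : MeanZeroPath × ℝ => max z.2 0 := continuous_snd.max continuous_const
  have hcq : Continuous fun z : MeanZeroPath × ℝ => z.1.1 :=
    continuous_subtype_val.comp continuous_fst
  have hlim : Tendsto (fun z : MeanZeroPath × ℝ =>
      odeConst (2 * R) * (|max z.2 0 - max z₀.2 0| + ‖z.1.1 - z₀.1.1‖)) (𝓝 z₀) (𝓝 0) := by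
    have hc : Continuous fun z : MeanZeroPath × ℝ =>
        odeConst (2 * R) * (|max z.2 0 - max z₀.2 0| + ‖z.1.1 - z₀.1.1‖) :=
      continuous_const.mul ((hcs.sub continuous_const).abs.add (hcq.sub continuous_const).norm)
    simpa using hc.tendsto z₀
  refine squeeze_zero' (Eventually.of_forall fun z => norm_nonneg _) ?_ hlim
  filter_upwards [hcs.continuousAt.eventually_lt_const (lt_add_one (max z₀.2 0)),
    hcq.norm.continuousAt.eventually_lt_const (lt_add_one ‖z₀.1.1‖)] with z hz1 hz2
  refine circle_norm_le fun x hx => ?_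
  rw [ContinuousMap.sub_apply, riccatiPath_coe, riccatiPath_coe]
  have h := isRiccatiSolution_riccati (le_max_right z.2 0) z.1
  have h₀ := isRiccatiSolution_riccati (le_max_right z₀.2 0) z₀.1
  refine IsRiccatiSolution.abs_sub_le (le_max_right _ _) (le_max_right _ _) h h₀
    (fun x => (h.abs_add_le (le_max_right _ _) x).trans ?_)
    (fun x => (h₀.abs_add_le (le_max_right _ _) x).trans ?_)
    (fun x => abs_coe_le_norm (z.1.1 - z₀.1.1) x) hx
  · rw [hR]; linarith
  · rw [hR]; linarith

/-- The cross term vanishes because `p̃` has mean zero. Continuity of `Φ + s²` thereby follows from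
that of the path. -/
theorem Phi_add_sq {s : ℝ} (hs : 0 ≤ s) (qt : MeanZeroPath) :
    Phi s qt + s ^ 2 = circleMean (riccatiPath (qt, s) * riccatiPath (qt, s)) := by
  have h := isRiccatiSolution_riccati hs qt
  have hc := h.continuous
  rw [circleMean_apply, Phi]
  have h1 : ∀ x : ℝ, (riccatiPath (qt, s) * riccatiPath (qt, s)) (x : UnitAddCircle) =
      riccati s qt x ^ 2 + (2 * s * riccati s qt x + s ^ 2) := fun x => by
    rw [ContinuousMap.mul_apply, riccatiPath_coe_of_nonneg hs]; ring
  rw [intervalIntegral.integral_congr fun x _ => h1 x,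
    intervalIntegral.integral_add (Continuous.intervalIntegrable (by fun_prop) _ _)
    (Continuous.intervalIntegrable (by fun_prop) _ _),
    intervalIntegral.integral_add (Continuous.intervalIntegrable (by fun_prop) _ _) (by simp),
    intervalIntegral.integral_const_mul, h.mean_zero]
  simp

theorem Phi_nonneg (s : ℝ) (qt : MeanZeroPath) : 0 ≤ Phi s qt :=
  intervalIntegral.integral_nonneg zero_le_one fun _ _ => sq_nonneg _

theorem circleMean_riccatiPath {s : ℝ} (hs : 0 ≤ s) (qt : MeanZeroPath) :
    circleMean (riccatiPath (qt, s)) = s := by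
  rw [circleMean_apply, intervalIntegral.integral_congr fun x _ => riccatiPath_coe_of_nonneg hs qt x,
    (isRiccatiSolution_riccati hs qt).integral_add_const]

theorem jacobianInv_eq {s : ℝ} (hs : 0 ≤ s) (qt : MeanZeroPath) :
    jacobianInv s qt = jacobianInvOf fun x : ℝ => riccatiPath (qt, s) (x : UnitAddCircle) := by
  have h := circleMean_riccatiPath hs qt
  rw [circleMean_apply] at h
  rw [jacobianInvOf, h]
  simp only [riccatiPath_coe_of_nonneg hs]
  rfl

theorem continuousAt_jacobianInvOf {b : C(UnitAddCircle, ℝ)} (hb : 0 < circleMean b) :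
    ContinuousAt (fun b : C(UnitAddCircle, ℝ) =>
      jacobianInvOf fun x : ℝ => b (x : UnitAddCircle)) b := by
  have heval : Continuous fun z : C(UnitAddCircle, ℝ) × ℝ => z.1 (z.2 : UnitAddCircle) :=
    continuous_fst.eval ((AddCircle.continuous_mk' 1).comp continuous_snd)
  have hB : Continuous fun z : C(UnitAddCircle, ℝ) × ℝ =>
      ∫ t in (0 : ℝ)..z.2, z.1 (t : UnitAddCircle) :=
    intervalIntegral.continuous_parametric_primitive_of_continuous
      (f := fun (b : C(UnitAddCircle, ℝ)) (t : ℝ) => b (t : UnitAddCircle)) heval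
  have hF : Continuous fun z : (C(UnitAddCircle, ℝ) × ℝ) × ℝ =>
      Real.exp (2 * ∫ t in (0 : ℝ)..z.1.2, z.1.1 (t : UnitAddCircle)) *
        Real.exp (-2 * ∫ t in (0 : ℝ)..z.2, z.1.1 (t : UnitAddCircle)) := by
    have h1 := hB.comp (continuous_fst (X := C(UnitAddCircle, ℝ) × ℝ) (Y := ℝ))
    have h2 := hB.comp ((continuous_fst.comp continuous_fst).prodMk continuous_snd :
      Continuous fun z : (C(UnitAddCircle, ℝ) × ℝ) × ℝ => (z.1.1, z.2))
    exact (Real.continuous_exp.comp (continuous_const.mul h1)).mul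
      (Real.continuous_exp.comp (continuous_const.mul h2))
  have hG1 : Continuous fun b : C(UnitAddCircle, ℝ) => ∫ x in (0 : ℝ)..1, ∫ y in (0 : ℝ)..1,
      Real.exp (2 * ∫ t in (0 : ℝ)..x, b (t : UnitAddCircle)) *
        Real.exp (-2 * ∫ t in (0 : ℝ)..y, b (t : UnitAddCircle)) := by
    have h1 := intervalIntegral.continuous_parametric_intervalIntegral_of_continuous (μ := volume)
      (a₀ := 0) (f := fun (z : C(UnitAddCircle, ℝ) × ℝ) (y : ℝ) =>
        Real.exp (2 * ∫ t in (0 : ℝ)..z.2, z.1 (t : UnitAddCircle)) *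
        Real.exp (-2 * ∫ t in (0 : ℝ)..y, z.1 (t : UnitAddCircle))) hF
      (continuous_const (y := (1 : ℝ)))
    exact intervalIntegral.continuous_parametric_intervalIntegral_of_continuous (μ := volume)
      (a₀ := 0) (f := fun (b : C(UnitAddCircle, ℝ)) (x : ℝ) => ∫ y in (0 : ℝ)..1,
        Real.exp (2 * ∫ t in (0 : ℝ)..x, b (t : UnitAddCircle)) *
        Real.exp (-2 * ∫ t in (0 : ℝ)..y, b (t : UnitAddCircle))) h1
      (continuous_const (y := (1 : ℝ)))
  have hG2 : Continuous fun b : C(UnitAddCircle, ℝ) => ∫ x in (0 : ℝ)..1, ∫ y in (0 : ℝ)..x,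
      Real.exp (2 * ∫ t in (0 : ℝ)..x, b (t : UnitAddCircle)) *
        Real.exp (-2 * ∫ t in (0 : ℝ)..y, b (t : UnitAddCircle)) := by
    have h1 := intervalIntegral.continuous_parametric_intervalIntegral_of_continuous (μ := volume)
      (a₀ := 0) (f := fun (z : C(UnitAddCircle, ℝ) × ℝ) (y : ℝ) =>
        Real.exp (2 * ∫ t in (0 : ℝ)..z.2, z.1 (t : UnitAddCircle)) *
        Real.exp (-2 * ∫ t in (0 : ℝ)..y, z.1 (t : UnitAddCircle))) hF continuous_snd
    exact intervalIntegral.continuous_parametric_intervalIntegral_of_continuous (μ := volume)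
      (a₀ := 0) (f := fun (b : C(UnitAddCircle, ℝ)) (x : ℝ) => ∫ y in (0 : ℝ)..x,
        Real.exp (2 * ∫ t in (0 : ℝ)..x, b (t : UnitAddCircle)) *
        Real.exp (-2 * ∫ t in (0 : ℝ)..y, b (t : UnitAddCircle))) h1
      (continuous_const (y := (1 : ℝ)))
  have hpre : ContinuousAt (fun b : C(UnitAddCircle, ℝ) =>
      1 / (1 - Real.exp (-2 * ∫ t in (0 : ℝ)..1, b (t : UnitAddCircle)))) b := by
    have hc : Continuous fun b : C(UnitAddCircle, ℝ) =>
        1 - Real.exp (-2 * ∫ t in (0 : ℝ)..1, b (t : UnitAddCircle)) :=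
      continuous_const.sub (Real.continuous_exp.comp (continuous_const.mul circleMean.continuous))
    refine continuousAt_const.div hc.continuousAt ?_
    rw [circleMean_apply] at hb
    have : Real.exp (-2 * ∫ t in (0 : ℝ)..1, b (t : UnitAddCircle)) < 1 :=
      Real.exp_lt_one_iff.2 (by linarith)
    linarith
  exact (hpre.mul hG1.continuousAt).sub hG2.continuousAt

theorem jacobian_pos {s : ℝ} (hs : 0 < s) (qt : MeanZeroPath) : 0 < jacobian s qt := by
  rw [jacobian, jacobianInv_eq hs.le]
  refine inv_pos.2 (jacobianInvOf_pos (continuous_coe_circle _) ?_)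
  rw [← circleMean_apply, circleMean_riccatiPath hs.le]
  exact hs

theorem continuousOn_jacobian :
    ContinuousOn (fun z : MeanZeroPath × ℝ => jacobian z.2 z.1) {z | 0 < z.2} := by
  have h : ContinuousOn (fun z : MeanZeroPath × ℝ =>
      (jacobianInvOf fun x : ℝ => riccatiPath z (x : UnitAddCircle))⁻¹) {z | 0 < z.2} := by
    rintro ⟨qt, s⟩ (hs : 0 < s)
    have hm : 0 < circleMean (riccatiPath (qt, s)) := by rwa [circleMean_riccatiPath hs.le]
    refine ContinuousAt.continuousWithinAt (ContinuousAt.inv₀ ?_ ?_)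
    · exact ContinuousAt.comp (g := fun b : C(UnitAddCircle, ℝ) =>
        jacobianInvOf fun x : ℝ => b (x : UnitAddCircle)) (continuousAt_jacobianInvOf hm)
        continuous_riccatiPath.continuousAt
    · exact (jacobianInvOf_pos (continuous_coe_circle _) hm).ne'
  refine h.congr ?_
  rintro ⟨qt, s⟩ (hs : 0 < s)
  simp only [jacobian, jacobianInv_eq hs.le]

/-- The difference quotient of `q₀` is the Jacobian of the average path. -/
theorem sub_mul_jacobianInvOf {s t : ℝ} (hs : 0 ≤ s) (ht : 0 ≤ t) (hst : 0 < s + t)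
    (qt : MeanZeroPath) :
    ((Phi t qt + t ^ 2) - (Phi s qt + s ^ 2)) * (jacobianInvOf fun x : ℝ =>
      ((2 : ℝ)⁻¹ • (riccatiPath (qt, t) + riccatiPath (qt, s))) (x : UnitAddCircle)) = t - s := by
  have h₁ := isRiccatiSolution_riccati ht qt
  have h₂ := isRiccatiSolution_riccati hs qt
  have hc₁ := h₁.continuous
  have hc₂ := h₂.continuous
  -- With equal `q̃` the forcing term drops out, and the sum of the two paths is twice their
  -- average, the `b` of `mul_jacobianInvOf`.
  rw [mul_jacobianInvOf (w := fun x => (riccati t qt x + t) - (riccati s qt x + s))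
    (continuous_coe_circle _)]
  · rw [intervalIntegral.integral_sub (Continuous.intervalIntegrable (by fun_prop) _ _)
        (Continuous.intervalIntegrable (by fun_prop) _ _), h₁.integral_add_const,
        h₂.integral_add_const]
  · rw [← circleMean_apply, map_smul, map_add, circleMean_riccatiPath ht,
      circleMean_riccatiPath hs, smul_eq_mul]
    linarith
  · intro x
    refine (h₁.hasDerivAt_sub h₂ x).congr_deriv ?_
    simp only [ContinuousMap.smul_apply, ContinuousMap.add_apply, riccatiPath_coe_of_nonneg hs,
      riccatiPath_coe_of_nonneg ht, smul_eq_mul, Phi]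
    ring
  · have e₁ := h₁.periodic 0
    have e₂ := h₂.periodic 0
    rw [zero_add] at e₁ e₂
    simp only [e₁, e₂]

/-- The average path has mean `(s + t) / 2 > 0` even when `s = 0`, so its reciprocal Jacobian is
positive. -/
theorem strictMonoOn_Phi_add_sq (qt : MeanZeroPath) :
    StrictMonoOn (fun s => Phi s qt + s ^ 2) (Set.Ici 0) := by
  intro s (hs : 0 ≤ s) t (ht : 0 ≤ t) hst
  have h := sub_mul_jacobianInvOf hs ht (by linarith) qt
  have hpos : 0 < jacobianInvOf fun x : ℝ =>
      ((2 : ℝ)⁻¹ • (riccatiPath (qt, t) + riccatiPath (qt, s))) (x : UnitAddCircle) := by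
    refine jacobianInvOf_pos (continuous_coe_circle _) ?_
    rw [← circleMean_apply, map_smul, map_add, circleMean_riccatiPath ht,
      circleMean_riccatiPath hs, smul_eq_mul]
    linarith
  have h1 : 0 < (Phi t qt + t ^ 2) - (Phi s qt + s ^ 2) := by
    by_contra! hneg
    nlinarith
  simpa using h1

theorem continuousOn_Phi_add_sq :
    ContinuousOn (fun z : MeanZeroPath × ℝ => Phi z.2 z.1 + z.2 ^ 2) {z | 0 ≤ z.2} := by
  refine (circleMean.continuous.comp
    (continuous_riccatiPath.mul continuous_riccatiPath)).continuousOn.congr ?_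
  rintro ⟨qt, s⟩ (hs : 0 ≤ s)
  exact Phi_add_sq hs qt

/-- The slope equals the reciprocal of `jacobianInvOf` at the average path, and that path tends to
the one at `s`. Only continuity of `p̃` in `s` is needed. -/
theorem hasDerivAt_Phi_add_sq {s : ℝ} (hs : 0 < s) (qt : MeanZeroPath) :
    HasDerivAt (fun t => Phi t qt + t ^ 2) (jacobian s qt) s := by
  rw [hasDerivAt_iff_tendsto_slope]
  set b : ℝ → C(UnitAddCircle, ℝ) := fun t =>
    (2 : ℝ)⁻¹ • (riccatiPath (qt, t) + riccatiPath (qt, s)) with hb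
  have hbc : Continuous b := by
    have h : Continuous fun t : ℝ => riccatiPath (qt, t) :=
      continuous_riccatiPath.comp (continuous_const.prodMk continuous_id)
    exact (h.add continuous_const).const_smul (2 : ℝ)⁻¹
  have hbs : b s = riccatiPath (qt, s) := by
    simp only [hb]
    rw [← two_smul ℝ, smul_smul]
    norm_num
  have hm : 0 < circleMean (b s) := by rwa [hbs, circleMean_riccatiPath hs.le]
  have hlim : Tendsto (fun t => (jacobianInvOf fun x : ℝ => b t (x : UnitAddCircle))⁻¹) (𝓝 s)
      (𝓝 (jacobian s qt)) := by
    rw [jacobian, jacobianInv_eq hs.le, ← hbs]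
    refine ContinuousAt.inv₀ ?_ (jacobianInvOf_pos (continuous_coe_circle _) hm).ne'
    exact ContinuousAt.comp (g := fun b : C(UnitAddCircle, ℝ) =>
        jacobianInvOf fun x : ℝ => b (x : UnitAddCircle)) (continuousAt_jacobianInvOf hm)
        hbc.continuousAt
  refine (hlim.mono_left nhdsWithin_le_nhds).congr' ?_
  filter_upwards [self_mem_nhdsWithin, nhdsWithin_le_nhds (lt_mem_nhds hs)] with t hts ht
  have h := sub_mul_jacobianInvOf hs.le ht.le (by linarith) qt
  have hts' : t - s ≠ 0 := sub_ne_zero.2 hts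
  change _ * (jacobianInvOf fun x : ℝ => b t (x : UnitAddCircle)) = _ at h
  have hj : (jacobianInvOf fun x : ℝ => b t (x : UnitAddCircle)) ≠ 0 := fun h0 => by
    rw [h0, mul_zero] at h; exact hts' h.symm
  rw [slope_def_field, eq_div_iff hts', ← h]
  field_simp

/-! ### The ground state -/

theorem eq_zero_of_periodic_linear_ode {a w : ℝ → ℝ} (ha : Continuous a)
    (hw : ∀ x, HasDerivAt w (-(a x * w x)) x) (hper : w 1 = w 0)
    (hσ : ∫ x in (0 : ℝ)..1, a x ≠ 0) : w = 0 := by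
  have h : ∀ x, w x * Real.exp (∫ t in (0 : ℝ)..x, a t) = w 0 := fun x => by
    simpa using mul_exp_primitive_eq (k := 0) (g := fun _ => 0) ha continuous_const
      (fun x => (hw x).congr_deriv (by ring)) x
  have h0 : w 0 = 0 := by
    by_contra h0
    have h1 := h 1
    rw [hper] at h1
    exact hσ (Real.exp_eq_one_iff _ |>.1 (mul_left_cancel₀ h0 (h1.trans (mul_one _).symm)))
  funext x
  have h1 := h x
  rw [h0] at h1
  simpa [Real.exp_ne_zero] using h1

theorem exists_Phi_add_sq_eq {qt : MeanZeroPath} {c : ℝ} (hc : Phi 0 qt < c) :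
    ∃ s, 0 < s ∧ Phi s qt + s ^ 2 = c := by
  have hc0 : 0 < c := (Phi_nonneg 0 qt).trans_lt hc
  have hcont : ContinuousOn (fun s => Phi s qt + s ^ 2) (Set.Icc 0 (c + 1)) :=
    (continuousOn_Phi_add_sq.comp (f := fun s : ℝ => (qt, s)) (s := Set.Ici 0)
      (continuous_const.prodMk continuous_id).continuousOn fun s hs => hs).mono
      Set.Icc_subset_Ici_self
  -- As `Φ ≥ 0` and `c > 0`, the value at `c + 1` is at least `(c + 1)² > c`.
  obtain ⟨s, hs, hsc⟩ := intermediate_value_Icc (by linarith) hcont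
    (show c ∈ Set.Icc (Phi 0 qt + 0 ^ 2) (Phi (c + 1) qt + (c + 1) ^ 2) from
      ⟨by linarith, by nlinarith [Phi_nonneg (c + 1) qt]⟩)
  refine ⟨s, lt_of_le_of_ne hs.1 ?_, hsc⟩
  rintro rfl
  simp only [ne_eq, OfNat.ofNat_ne_zero, not_false_eq_true, zero_pow, add_zero] at hsc
  exact hc.ne hsc

/-- The path at `s = 0` is a logarithmic derivative of mean zero, so its exponential primitive is
periodic, and Riccati's equation becomes Hill's. -/
theorem isHillEigenvalue_sub_Phi (q₀ : ℝ) (qt : MeanZeroPath) :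
    IsHillEigenvalue (ContinuousMap.const _ q₀ + qt.1) (q₀ - Phi 0 qt) := by
  have h := isRiccatiSolution_riccati le_rfl qt
  set p := riccati 0 qt with hp
  refine ⟨fun x => Real.exp (∫ t in (0 : ℝ)..x, p t),
    fun x => Real.exp (∫ t in (0 : ℝ)..x, p t) * p x, fun h0 => ?_, fun x => ?_,
    hasDerivAt_exp_primitive h.continuous, fun x => ?_⟩
  · exact Real.exp_ne_zero _ (congrFun h0 0)
  · have h1 := h.periodic.intervalIntegral_add_eq x 0
    rw [zero_add, h.mean_zero] at h1
    have h2 := intervalIntegral.integral_add_adjacent_intervals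
      (h.continuous.intervalIntegrable (μ := volume) 0 x)
      (h.continuous.intervalIntegrable (μ := volume) x (x + 1))
    simp only
    rw [← h2, h1, add_zero]
  · refine ((hasDerivAt_exp_primitive h.continuous x).mul (h.ode x)).congr_deriv ?_
    simp only [ContinuousMap.add_apply, ContinuousMap.const_apply, Phi, ← hp]
    ring

/-- Choose `s > 0` with `Φ + s² = q₀ - E` and put `P = p̃ + s`. Then `-d² + q - E = -(d + P)(d - P)`
for `q = q₀ + q̃`. Neither first order factor has a nonzero periodic null function, because `∫ P = s
≠ 0`. -/
theorem not_isHillEigenvalue (q₀ : ℝ) (qt : MeanZeroPath) {E : ℝ} (hE : E < q₀ - Phi 0 qt) :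
    ¬ IsHillEigenvalue (ContinuousMap.const _ q₀ + qt.1) E := by
  rintro ⟨ψ, dψ, hne, hper, hψ, hdψ⟩
  obtain ⟨s, hs, hsc⟩ := exists_Phi_add_sq_eq (qt := qt) (c := q₀ - E) (by linarith)
  have h := isRiccatiSolution_riccati hs.le qt
  have hc := h.continuous
  have hint := h.integral_add_const s
  simp only [Phi] at hsc
  set p := riccati s qt with hp
  have hperp : p 1 = p 0 := by simpa using h.periodic 0
  have hperψ : ψ 1 = ψ 0 := by simpa using hper 0
  -- Periodicity is assumed of `ψ` only; that of its derivative follows by uniqueness of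
  -- derivatives.
  have hperd : dψ 1 = dψ 0 := by
    have h1 : HasDerivAt (fun x => ψ (x + 1)) (dψ (0 + 1)) 0 := (hψ (0 + 1)).comp_add_const 0 1
    rw [funext hper, zero_add] at h1
    exact h1.unique (hψ 0)
  have hχ : (fun x => dψ x - (p x + s) * ψ x) = 0 := by
    refine eq_zero_of_periodic_linear_ode (a := fun x => p x + s) (by fun_prop) (fun x => ?_)
      (by simp only [hperp, hperψ, hperd]) (by rw [hint]; exact hs.ne')
    refine ((hdψ x).sub (((h.ode x).add_const s).mul (hψ x))).congr_deriv ?_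
    simp only [ContinuousMap.add_apply, ContinuousMap.const_apply]
    linear_combination -ψ x * hsc
  refine hne (eq_zero_of_periodic_linear_ode (a := fun x => -(p x + s)) (by fun_prop) (fun x => ?_)
    hperψ (by rw [intervalIntegral.integral_neg, hint]; simpa using hs.ne'))
  refine (hψ x).congr_deriv ?_
  have := congrFun hχ x
  simp only [Pi.zero_apply] at this
  linarith

theorem groundState_const_add (q₀ : ℝ) (qt : MeanZeroPath) :
    groundState (ContinuousMap.const _ q₀ + qt.1) = q₀ - Phi 0 qt := by
  refine IsLeast.csInf_eq ⟨isHillEigenvalue_sub_Phi q₀ qt, fun E hE => ?_⟩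
  by_contra! hlt
  exact not_isHillEigenvalue q₀ qt hlt hE

theorem bijOn_Phi_add_sq (lam : ℝ) (qt : MeanZeroPath) :
    Set.BijOn (fun s : ℝ => lam + Phi s qt + s ^ 2) (Set.Ioi 0)
      {q₀ : ℝ | lam < groundState (ContinuousMap.const _ q₀ + qt.1)} := by
  have hmono := strictMonoOn_Phi_add_sq qt
  simp only [groundState_const_add]
  refine ⟨fun s (hs : 0 < s) => ?_, fun s (hs : 0 < s) t (ht : 0 < t) hst => ?_, fun q₀ hq => ?_⟩
  · have h1 := hmono (Set.mem_Ici.2 le_rfl) hs.le hs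
    simp only [Set.mem_ofPred_eq]
    simp only [ne_eq, OfNat.ofNat_ne_zero, not_false_eq_true, zero_pow, add_zero] at h1
    linarith
  · exact hmono.injOn hs.le ht.le (by simp only at hst ⊢; linarith)
  · obtain ⟨s, hs, hsc⟩ := exists_Phi_add_sq_eq (qt := qt) (c := q₀ - lam)
      (by simp only [Set.mem_ofPred_eq] at hq; linarith)
    exact ⟨s, hs, by simp only; linarith⟩

/-! ### Measurability of random paths -/

/-- By continuity the uniform distance to a fixed path is decided on a countable dense set, so balls
have measurable preimages. Every open set is a countable union of balls. -/
theorem measurable_of_eval {α : Type*} [MeasurableSpace α] {f : α → MeanZeroPath}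
    (hf : ∀ x : UnitAddCircle, Measurable fun a => (f a).1 x) : Measurable f := by
  have hball : ∀ (c : MeanZeroPath) (r : ℝ), MeasurableSet (f ⁻¹' Metric.ball c r) := by
    intro c r
    have hdist : Measurable fun a => dist (f a) c := by
      refine measurable_of_Iic fun R => ?_
      rcases lt_or_ge R 0 with hR | hR
      · convert MeasurableSet.empty
        ext a
        simpa using hR.trans_le dist_nonneg
      · have h : (fun a => dist (f a) c) ⁻¹' Set.Iic R =
            ⋂ n : ℕ, {a | |(f a).1 (TopologicalSpace.denseSeq UnitAddCircle n) -
              c.1 (TopologicalSpace.denseSeq UnitAddCircle n)| ≤ R} := by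
          ext a
          simp only [Set.mem_preimage, Set.mem_Iic, Set.mem_iInter, Set.mem_ofPred_eq]
          rw [Subtype.dist_eq, ContinuousMap.dist_le hR]
          refine ⟨fun h n => h _, fun h => ?_⟩
          exact fun x => (TopologicalSpace.denseRange_denseSeq UnitAddCircle).induction_on
            (p := fun x => dist ((f a).1 x) (c.1 x) ≤ R)
            x (isClosed_le ((f a).1.continuous.dist c.1.continuous) continuous_const) h
        rw [h]
        exact MeasurableSet.iInter fun n =>
          measurableSet_le ((hf _).sub measurable_const).abs measurable_const
    exact measurableSet_lt hdist measurable_const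
  refine measurable_of_isOpen fun U hU => ?_
  choose! r hr hrU using Metric.isOpen_iff.1 hU
  obtain ⟨S, hSU, hS, hSeq⟩ := TopologicalSpace.isOpen_biUnion_countable U
    (fun c => Metric.ball c (r c)) fun c _ => Metric.isOpen_ball
  have hUeq : U = ⋃ c ∈ S, Metric.ball c (r c) := by
    rw [hSeq]
    exact Set.Subset.antisymm (fun c hc => Set.mem_biUnion hc (Metric.mem_ball_self (hr c hc)))
      (Set.iUnion₂_subset hrU)
  rw [hUeq, Set.preimage_iUnion₂]
  exact MeasurableSet.biUnion hS fun c _ => hball c _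

theorem aemeasurable_of_eval {Ω : Type*} [MeasurableSpace Ω] {P : Measure Ω} {f : Ω → MeanZeroPath}
    (hf : ∀ x : UnitAddCircle, AEMeasurable (fun ω => (f ω).1 x) P) : AEMeasurable f P := by
  -- Passing to the null-measurable σ-algebra lets the pointwise criterion apply without treating
  -- uncountably many exceptional sets.
  refine NullMeasurable.aemeasurable ?_
  exact measurable_of_eval (α := NullMeasurableSpace Ω P) fun x => (hf x).nullMeasurable

/-! ### Riemann sums on the circle -/

/-- The `n`-th Riemann sum of a function on the circle. -/
noncomputable def riemannSum (n : ℕ) (f : UnitAddCircle → ℝ) : ℝ :=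
  ∑ i ∈ Finset.range n, (n : ℝ)⁻¹ * f ((i / n : ℝ) : UnitAddCircle)

theorem abs_riemannSum_sub_le {f : C(UnitAddCircle, ℝ)} {ε : ℝ} {n : ℕ} (hn : 0 < n)
    (hf : ∀ x y : ℝ, |x - y| ≤ (n : ℝ)⁻¹ → |f (x : UnitAddCircle) - f (y : UnitAddCircle)| ≤ ε) :
    |riemannSum n f - circleMean f| ≤ ε := by
  have hn' : (0 : ℝ) < n := Nat.cast_pos.2 hn
  have hfc := continuous_coe_circle f
  have h1 : circleMean f = ∑ i ∈ Finset.range n,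
      ∫ x in ((i : ℕ) / n : ℝ)..((i + 1 : ℕ) / n : ℝ), f (x : UnitAddCircle) := by
    rw [intervalIntegral.sum_integral_adjacent_intervals (a := fun i : ℕ => (i / n : ℝ))
      fun i _ => hfc.intervalIntegrable _ _, circleMean_apply]
    simp [hn'.ne']
  have hlen : ∀ i : ℕ, ((i + 1 : ℕ) / n : ℝ) - (i / n : ℝ) = (n : ℝ)⁻¹ := fun i => by
    push_cast; field_simp; ring
  rw [h1, riemannSum, ← Finset.sum_sub_distrib]
  calc _ ≤ ∑ i ∈ Finset.range n, ε * (n : ℝ)⁻¹ := by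
        refine (Finset.abs_sum_le_sum_abs _ _).trans (Finset.sum_le_sum fun i _ => ?_)
        have hle : (i / n : ℝ) ≤ ((i + 1 : ℕ) / n : ℝ) := by
          have := hlen i; have := inv_pos.2 hn'; linarith
        have h2 : (n : ℝ)⁻¹ * f ((i / n : ℝ) : UnitAddCircle) =
            ∫ x in ((i : ℕ) / n : ℝ)..((i + 1 : ℕ) / n : ℝ), f ((i / n : ℝ) : UnitAddCircle) := by
          rw [intervalIntegral.integral_const, hlen, smul_eq_mul]
        rw [h2, ← intervalIntegral.integral_sub (by simp) (hfc.intervalIntegrable _ _)]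
        have h3 := intervalIntegral.norm_integral_le_of_norm_le_const (C := ε)
          (a := (i / n : ℝ)) (b := ((i + 1 : ℕ) / n : ℝ))
          (f := fun x : ℝ => f ((i / n : ℝ) : UnitAddCircle) - f (x : UnitAddCircle))
          fun x hx => by
            rw [Set.uIoc_of_le hle] at hx
            refine hf _ _ ?_
            rw [abs_le]
            have := hlen i
            have := inv_pos.2 hn'
            constructor <;> linarith [hx.1, hx.2]
        rwa [hlen, abs_of_pos (inv_pos.2 hn')] at h3
    _ = ε := by
        rw [Finset.sum_const, Finset.card_range, nsmul_eq_mul]; field_simp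

theorem uniformContinuous_coe_circle (f : C(UnitAddCircle, ℝ)) {ε : ℝ} (hε : 0 < ε) :
    ∃ δ > 0, ∀ (x y : ℝ) (z : UnitAddCircle), |x - y| < δ →
      |f ((x : UnitAddCircle) - z) - f ((y : UnitAddCircle) - z)| < ε := by
  obtain ⟨η, hη, hf⟩ := Metric.uniformContinuous_iff.1
    (CompactSpace.uniformContinuous_of_continuous f.continuous) ε hε
  have hc : UniformContinuous ((↑) : ℝ → UnitAddCircle) :=
    uniformContinuous_addMonoidHom_of_continuous
      (f := QuotientAddGroup.mk' (AddSubgroup.zmultiples (1 : ℝ))) (AddCircle.continuous_mk' 1)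
  obtain ⟨δ, hδ, h⟩ := Metric.uniformContinuous_iff.1 hc η hη
  refine ⟨δ, hδ, fun x y z hxy => ?_⟩
  rw [← Real.dist_eq]
  refine hf ?_
  rw [dist_sub_right]
  exact h (by rwa [Real.dist_eq])

/-- Uniformity in the translation `z` comes from uniform continuity on the compact circle; it allows
averaging over `z` in the double sum. -/
theorem eventually_abs_riemannSum_sub_le (f : C(UnitAddCircle, ℝ)) {ε : ℝ} (hε : 0 < ε) :
    ∀ᶠ n : ℕ in atTop, ∀ z : UnitAddCircle,
      |riemannSum n (fun x => f (x - z)) - circleMean f| ≤ ε := by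
  obtain ⟨δ, hδ, h⟩ := uniformContinuous_coe_circle f hε
  have hlim : ∀ᶠ n : ℕ in atTop, (n : ℝ)⁻¹ < δ :=
    (tendsto_inv_atTop_zero.comp tendsto_natCast_atTop_atTop).eventually_lt_const hδ
  filter_upwards [hlim, eventually_gt_atTop 0] with n hn hn0 z
  have hmean : circleMean f =
      circleMean (f.comp ⟨fun x => x - z, continuous_id.sub continuous_const⟩) := by
    rw [circleMean_eq_integral, circleMean_eq_integral]
    exact (integral_sub_right_eq_self (μ := (volume : Measure UnitAddCircle)) f z).symm
  rw [hmean]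
  exact abs_riemannSum_sub_le (f := f.comp ⟨fun x => x - z, continuous_id.sub continuous_const⟩)
    hn0 fun x y hxy => (h x y z (hxy.trans_lt hn)).le

theorem tendsto_riemannSum (f : C(UnitAddCircle, ℝ)) (z : UnitAddCircle) :
    Tendsto (fun n => riemannSum n fun x => f (x - z)) atTop (𝓝 (circleMean f)) := by
  refine Metric.tendsto_nhds.2 fun ε hε => ?_
  filter_upwards [eventually_abs_riemannSum_sub_le f (half_pos hε)] with n hn
  rw [Real.dist_eq]
  exact (hn z).trans_lt (half_lt_self hε)

theorem tendsto_riemannSum_riemannSum (f : C(UnitAddCircle, ℝ)) :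
    Tendsto (fun n => riemannSum n fun z => riemannSum n fun x => f (x - z)) atTop
      (𝓝 (circleMean f)) := by
  refine Metric.tendsto_nhds.2 fun ε hε => ?_
  filter_upwards [eventually_abs_riemannSum_sub_le f (half_pos hε), eventually_gt_atTop 0]
    with n hn hn0
  rw [Real.dist_eq]
  refine lt_of_le_of_lt ?_ (half_lt_self hε)
  have hn' : (0 : ℝ) < n := Nat.cast_pos.2 hn0
  have h : riemannSum n (fun z => riemannSum n fun x => f (x - z)) - circleMean f =
      ∑ i ∈ Finset.range n, (n : ℝ)⁻¹ * (riemannSum n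
        (fun x => f (x - ((i / n : ℝ) : UnitAddCircle))) - circleMean f) := by
    simp only [mul_sub, Finset.sum_sub_distrib, Finset.sum_const, Finset.card_range,
      nsmul_eq_mul]
    rw [mul_inv_cancel_left₀ hn'.ne']
    rfl
  rw [h]
  calc _ ≤ ∑ i ∈ Finset.range n, (n : ℝ)⁻¹ * (ε / 2) := by
        refine (Finset.abs_sum_le_sum_abs _ _).trans (Finset.sum_le_sum fun i _ => ?_)
        rw [abs_mul, abs_of_pos (inv_pos.2 hn')]
        exact mul_le_mul_of_nonneg_left (hn _) (inv_pos.2 hn').le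
    _ = ε / 2 := by
        rw [Finset.sum_const, Finset.card_range, nsmul_eq_mul, mul_inv_cancel_left₀ hn'.ne']

/-! ### Limits of Gaussian variables -/

/-- The characteristic functions converge by dominated convergence, and those of centred Gaussians
depend continuously on the variance, degenerate case included. -/
theorem map_eq_gaussianReal_of_tendsto {Ω : Type*} [MeasurableSpace Ω] {P : Measure Ω}
    [IsProbabilityMeasure P] {Z : ℕ → Ω → ℝ} {Z₀ : Ω → ℝ} {v : ℕ → NNReal} {v₀ : NNReal}
    (hm : ∀ n, AEMeasurable (Z n) P) (hlaw : ∀ n, P.map (Z n) = gaussianReal 0 (v n))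
    (hlim : ∀ᵐ ω ∂P, Tendsto (fun n => Z n ω) atTop (𝓝 (Z₀ ω)))
    (hv : Tendsto v atTop (𝓝 v₀)) : P.map Z₀ = gaussianReal 0 v₀ := by
  have hm₀ : AEMeasurable Z₀ P := aemeasurable_of_tendsto_metrizable_ae atTop hm hlim
  have : IsProbabilityMeasure (P.map Z₀) := P.isProbabilityMeasure_map hm₀
  refine Measure.ext_of_charFun ?_
  ext t
  have hchar : ∀ {Y : Ω → ℝ}, AEMeasurable Y P →
      charFun (P.map Y) t = ∫ ω, Complex.exp (t * Y ω * Complex.I) ∂P := fun {Y} hY => by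
    rw [charFun_apply_real, integral_map hY]
    exact Continuous.aestronglyMeasurable (by fun_prop)
  have h1 : Tendsto (fun n => charFun (P.map (Z n)) t) atTop (𝓝 (charFun (P.map Z₀) t)) := by
    simp only [hchar (hm _), hchar hm₀]
    refine tendsto_integral_of_dominated_convergence (fun _ => 1) (fun n => ?_)
      (integrable_const _) (fun n => Eventually.of_forall fun ω => ?_) ?_
    · exact (Continuous.measurable (f := fun y : ℝ => Complex.exp (t * y * Complex.I))
        (by fun_prop)).comp_aemeasurable (hm n) |>.aestronglyMeasurable
    · rw [← Complex.ofReal_mul, Complex.norm_exp_ofReal_mul_I]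
    · filter_upwards [hlim] with ω hω
      exact ((Continuous.tendsto (f := fun y : ℝ => Complex.exp (t * y * Complex.I))
        (by fun_prop) _).comp hω)
  have h2 : Tendsto (fun n => charFun (P.map (Z n)) t) atTop
      (𝓝 (charFun (gaussianReal 0 v₀) t)) := by
    simp only [hlaw, charFun_gaussianReal]
    have hv' : Tendsto (fun n => ((v n : ℝ) : ℂ)) atTop (𝓝 ((v₀ : ℝ) : ℂ)) :=
      (Complex.continuous_ofReal.tendsto _).comp ((NNReal.continuous_coe.tendsto _).comp hv)
    exact (Complex.continuous_exp.tendsto _).comp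
      (tendsto_const_nhds.sub ((hv'.mul_const _).div_const _))
  exact tendsto_nhds_unique h1 h2

/-! ### The mean of a stationary Gaussian path is independent of its mean-zero part -/

section Gaussian

variable {Ω : Type*} [MeasurableSpace Ω] {P : Measure Ω} {Y : Ω → C(UnitAddCircle, ℝ)}
  {K : C(UnitAddCircle, ℝ)}

theorem integrable_const_mul_mul {f g : Ω → ℝ} (hf : MemLp f 2 P) (hg : MemLp g 2 P) (c : ℝ) :
    Integrable (fun ω => c * (f ω * g ω)) P :=
  (hf.integrable_mul hg).const_mul c

theorem isGaussianProcess_linearCombination (hY : IsGaussianProcess (fun x ω => Y ω x) P) :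
    IsGaussianProcess (fun (g : UnitAddCircle →₀ ℝ) ω =>
      Finsupp.linearCombination ℝ (fun x => Y ω x) g) P := by
  refine hY.of_isGaussianProcess fun g => ⟨g.support,
    ∑ i : g.support, g i • ContinuousLinearMap.proj i, fun ω => ?_⟩
  simp only [Finsupp.linearCombination_apply, Finsupp.sum, smul_eq_mul,
    _root_.sum_apply, _root_.smul_apply, ContinuousLinearMap.proj_apply,
    Finset.restrict]
  exact (Finset.sum_coe_sort g.support fun i => g i * Y ω i).symm

theorem memLp_two_linearCombination (hY : IsGaussianProcess (fun x ω => Y ω x) P)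
    (g : UnitAddCircle →₀ ℝ) :
    MemLp (fun ω => Finsupp.linearCombination ℝ (fun x => Y ω x) g) 2 P :=
  ((isGaussianProcess_linearCombination hY).hasGaussianLaw_eval g).memLp_two

theorem memLp_two_eval (hY : IsGaussianProcess (fun x ω => Y ω x) P) (x : UnitAddCircle) :
    MemLp (fun ω => Y ω x) 2 P :=
  (hY.hasGaussianLaw_eval x).memLp_two

theorem integral_linearCombination (hY : IsGaussianProcess (fun x ω => Y ω x) P)
    (hmean : ∀ x, ∫ ω, Y ω x ∂P = 0) (g : UnitAddCircle →₀ ℝ) :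
    ∫ ω, Finsupp.linearCombination ℝ (fun x => Y ω x) g ∂P = 0 := by
  have : IsProbabilityMeasure P := hY.isProbabilityMeasure
  simp only [Finsupp.linearCombination_apply, Finsupp.sum, smul_eq_mul]
  rw [integral_finsetSum _ fun x _ => ((memLp_two_eval hY x).integrable one_le_two).const_mul _]
  simp [integral_const_mul, hmean]

/-- The Riemann sum as a combination of evaluations. -/
noncomputable def riemannFinsupp (n : ℕ) : UnitAddCircle →₀ ℝ :=
  ∑ i ∈ Finset.range n, Finsupp.single ((i / n : ℝ) : UnitAddCircle) (n : ℝ)⁻¹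

theorem linearCombination_riemannFinsupp (n : ℕ) (f : UnitAddCircle → ℝ) :
    Finsupp.linearCombination ℝ f (riemannFinsupp n) = riemannSum n f := by
  simp [riemannFinsupp, riemannSum, Finsupp.linearCombination_single]

theorem integral_riemannSum_mul_eval (hY : IsGaussianProcess (fun x ω => Y ω x) P)
    (hcov : ∀ x y, ∫ ω, Y ω x * Y ω y ∂P = K (x - y)) (n : ℕ) (y : UnitAddCircle) :
    ∫ ω, riemannSum n (Y ω) * Y ω y ∂P = riemannSum n fun x => K (x - y) := by
  simp only [riemannSum, Finset.sum_mul, mul_assoc]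
  rw [integral_finsetSum _ fun i _ =>
    integrable_const_mul_mul (memLp_two_eval hY _) (memLp_two_eval hY y) _]
  simp only [integral_const_mul, hcov]

theorem memLp_two_riemannSum (hY : IsGaussianProcess (fun x ω => Y ω x) P) (n : ℕ) :
    MemLp (fun ω => riemannSum n (Y ω)) 2 P := by
  simpa only [linearCombination_riemannFinsupp] using
    memLp_two_linearCombination hY (riemannFinsupp n)

theorem integral_riemannSum_mul_riemannSum (hY : IsGaussianProcess (fun x ω => Y ω x) P)
    (hcov : ∀ x y, ∫ ω, Y ω x * Y ω y ∂P = K (x - y)) (n : ℕ) :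
    ∫ ω, riemannSum n (Y ω) * riemannSum n (Y ω) ∂P =
      riemannSum n fun z => riemannSum n fun x => K (x - z) := by
  have h : ∀ ω, riemannSum n (Y ω) * riemannSum n (Y ω) = ∑ i ∈ Finset.range n,
      (n : ℝ)⁻¹ * (riemannSum n (Y ω) * Y ω ((i / n : ℝ) : UnitAddCircle)) := fun ω => by
    change riemannSum n (Y ω) * ∑ i ∈ Finset.range n,
      (n : ℝ)⁻¹ * Y ω ((i / n : ℝ) : UnitAddCircle) = _
    rw [Finset.mul_sum]
    exact Finset.sum_congr rfl fun i _ => by ring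
  simp only [h]
  rw [integral_finsetSum _ fun i _ =>
    integrable_const_mul_mul (memLp_two_riemannSum hY n) (memLp_two_eval hY _) _]
  simp only [integral_const_mul, integral_riemannSum_mul_eval hY hcov]
  rfl

theorem tendsto_integral_riemannSum_mul (hY : IsGaussianProcess (fun x ω => Y ω x) P)
    (hcov : ∀ x y, ∫ ω, Y ω x * Y ω y ∂P = K (x - y)) (hK : circleMean K = 1)
    (g : UnitAddCircle →₀ ℝ) :
    Tendsto (fun n => ∫ ω, riemannSum n (Y ω) *
      Finsupp.linearCombination ℝ (fun x => Y ω x) g ∂P) atTop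
      (𝓝 (Finsupp.linearCombination ℝ (fun _ => (1 : ℝ)) g)) := by
  have h : ∀ n, ∫ ω, riemannSum n (Y ω) * Finsupp.linearCombination ℝ (fun x => Y ω x) g ∂P =
      ∑ y ∈ g.support, g y * riemannSum n fun x => K (x - y) := fun n => by
    have h1 : ∀ ω, riemannSum n (Y ω) * Finsupp.linearCombination ℝ (fun x => Y ω x) g =
        ∑ y ∈ g.support, g y * (riemannSum n (Y ω) * Y ω y) := fun ω => by
      simp only [Finsupp.linearCombination_apply, Finsupp.sum, smul_eq_mul, Finset.mul_sum]
      exact Finset.sum_congr rfl fun y _ => by ring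
    simp only [h1]
    rw [integral_finsetSum _ fun y _ =>
      integrable_const_mul_mul (memLp_two_riemannSum hY n) (memLp_two_eval hY _) _]
    simp only [integral_const_mul, integral_riemannSum_mul_eval hY hcov]
  simp only [h]
  simp only [Finsupp.linearCombination_apply, Finsupp.sum, smul_eq_mul]
  refine tendsto_finsetSum _ fun y _ => ?_
  have := (tendsto_riemannSum K y).const_mul (g y)
  rwa [hK] at this

/-- The mean is a pointwise limit of Riemann sums, so this variable is a limit of finite Gaussian
combinations. Their second moments converge because Riemann sums of `K` tend to `∫ K = 1`: both the
variance of the mean and its covariance with each evaluation are `1`. Nonnegativity is recorded so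
that `toNNReal` loses nothing. -/
theorem map_mean_add_linearCombination (hY : IsGaussianProcess (fun x ω => Y ω x) P)
    (hmean : ∀ x, ∫ ω, Y ω x ∂P = 0)
    (hcov : ∀ x y, ∫ ω, Y ω x * Y ω y ∂P = K (x - y)) (hK : circleMean K = 1)
    (c : ℝ) (g : UnitAddCircle →₀ ℝ) :
    0 ≤ c ^ 2 + 2 * c * Finsupp.linearCombination ℝ (fun _ => (1 : ℝ)) g +
      ∫ ω, Finsupp.linearCombination ℝ (fun x => Y ω x) g ^ 2 ∂P ∧
    P.map (fun ω => c * circleMean (Y ω) + Finsupp.linearCombination ℝ (fun x => Y ω x) g) =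
      gaussianReal 0 (c ^ 2 + 2 * c * Finsupp.linearCombination ℝ (fun _ => (1 : ℝ)) g +
        ∫ ω, Finsupp.linearCombination ℝ (fun x => Y ω x) g ^ 2 ∂P).toNNReal := by
  have : IsProbabilityMeasure P := hY.isProbabilityMeasure
  set Z : ℕ → Ω → ℝ := fun n ω =>
    c * riemannSum n (Y ω) + Finsupp.linearCombination ℝ (fun x => Y ω x) g with hZ
  have hZW : ∀ n, Z n = fun ω =>
      Finsupp.linearCombination ℝ (fun x => Y ω x) (c • riemannFinsupp n + g) := fun n => by
    funext ω
    simp only [hZ, map_add, map_smul, linearCombination_riemannFinsupp, smul_eq_mul]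
  have hgauss : ∀ n, HasGaussianLaw (Z n) P := fun n => by
    rw [hZW]; exact (isGaussianProcess_linearCombination hY).hasGaussianLaw_eval _
  have hZmean : ∀ n, ∫ ω, Z n ω ∂P = 0 := fun n => by
    rw [hZW]; exact integral_linearCombination hY hmean _
  have hvar : ∀ n, Var[Z n; P] = ∫ ω, Z n ω ^ 2 ∂P := fun n => by
    rw [variance_eq_sub (hgauss n).memLp_two, hZmean]; simp
  have hR := memLp_two_riemannSum hY
  have hW := memLp_two_linearCombination hY g
  have hsq : ∀ n, ∫ ω, Z n ω ^ 2 ∂P =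
      c ^ 2 * (∫ ω, riemannSum n (Y ω) * riemannSum n (Y ω) ∂P) +
      2 * c * (∫ ω, riemannSum n (Y ω) * Finsupp.linearCombination ℝ (fun x => Y ω x) g ∂P) +
      ∫ ω, Finsupp.linearCombination ℝ (fun x => Y ω x) g ^ 2 ∂P := fun n => by
    have i1 := integrable_const_mul_mul (hR n) (hR n) (c ^ 2)
    have i2 := integrable_const_mul_mul (hR n) hW (2 * c)
    have i3 : Integrable (fun ω => c ^ 2 * (riemannSum n (Y ω) * riemannSum n (Y ω)) + 2 * c *
      (riemannSum n (Y ω) * Finsupp.linearCombination ℝ (fun x => Y ω x) g)) P := i1.add i2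
    rw [← integral_const_mul, ← integral_const_mul, ← integral_add i1 i2,
      ← integral_add i3 hW.integrable_sq]
    refine integral_congr_ae (Eventually.of_forall fun ω => ?_)
    simp only [hZ]
    ring
  have hlim : Tendsto (fun n => ∫ ω, Z n ω ^ 2 ∂P) atTop
      (𝓝 (c ^ 2 + 2 * c * Finsupp.linearCombination ℝ (fun _ => (1 : ℝ)) g +
        ∫ ω, Finsupp.linearCombination ℝ (fun x => Y ω x) g ^ 2 ∂P)) := by
    simp only [hsq, integral_riemannSum_mul_riemannSum hY hcov]
    have h1 := (tendsto_riemannSum_riemannSum K).const_mul (c ^ 2)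
    rw [hK, mul_one] at h1
    exact (h1.add ((tendsto_integral_riemannSum_mul hY hcov hK g).const_mul (2 * c))).add_const _
  refine ⟨ge_of_tendsto' hlim fun n => integral_nonneg fun ω => sq_nonneg _, ?_⟩
  refine map_eq_gaussianReal_of_tendsto (Z := Z) (v := fun n => (∫ ω, Z n ω ^ 2 ∂P).toNNReal)
    (fun n => (hgauss n).aemeasurable) (fun n => ?_) (Eventually.of_forall fun ω => ?_)
    ((continuous_real_toNNReal.tendsto _).comp hlim)
  · rw [(hgauss n).map_eq_gaussianReal, hvar, hZmean]
  · refine Tendsto.add_const _ (Tendsto.const_mul c ?_)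
    simpa using tendsto_riemannSum (Y ω) 0

theorem aemeasurable_circleMean (hY : IsGaussianProcess (fun x ω => Y ω x) P) :
    AEMeasurable (fun ω => circleMean (Y ω)) P :=
  aemeasurable_of_tendsto_metrizable_ae atTop
    (fun n => (memLp_two_riemannSum hY n).aestronglyMeasurable.aemeasurable)
    (Eventually.of_forall fun ω => by simpa using tendsto_riemannSum (Y ω) 0)

theorem aemeasurable_meanZeroPart (hY : IsGaussianProcess (fun x ω => Y ω x) P) :
    AEMeasurable (fun ω => meanZeroPart (Y ω)) P :=
  aemeasurable_of_eval fun x => by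
    simp only [meanZeroPart_apply]
    exact (hY.aemeasurable x).sub (aemeasurable_circleMean hY)

theorem isGaussianProcess_mean_meanZeroPart (hY : IsGaussianProcess (fun x ω => Y ω x) P)
    (hmean : ∀ x, ∫ ω, Y ω x ∂P = 0)
    (hcov : ∀ x y, ∫ ω, Y ω x * Y ω y ∂P = K (x - y)) (hK : circleMean K = 1) :
    IsGaussianProcess (Sum.elim (fun (_ : Unit) ω => circleMean (Y ω))
      (fun x ω => (meanZeroPart (Y ω)).1 x)) P where
  hasGaussianLaw I := by
    set V : Unit ⊕ UnitAddCircle → Ω → ℝ := Sum.elim (fun (_ : Unit) ω => circleMean (Y ω))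
      (fun x ω => (meanZeroPart (Y ω)).1 x) with hV
    have hVm : ∀ i, AEMeasurable (V i) P := by
      rintro (_ | x)
      · exact aemeasurable_circleMean hY
      · simp only [hV, Sum.elim_inr, meanZeroPart_apply]
        exact (hY.aemeasurable x).sub (aemeasurable_circleMean hY)
    have hVI : AEMeasurable (fun ω => I.restrict (V · ω)) P :=
      aemeasurable_pi_lambda _ fun i => hVm i
    -- Coordinates of each variable as a multiple of the mean plus a combination of evaluations: the
    -- value of `q̃` at `x` is minus the mean plus the evaluation at `x`.
    let m : Unit ⊕ UnitAddCircle → ℝ × (UnitAddCircle →₀ ℝ) :=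
      Sum.elim (fun _ => (1, 0)) fun x => (-1, Finsupp.single x 1)
    have hm : ∀ i ω, V i ω = (m i).1 * circleMean (Y ω) +
        Finsupp.linearCombination ℝ (fun x => Y ω x) (m i).2 := by
      rintro (_ | x) ω
      · simp [hV, m]
      · simp [hV, m, meanZeroPart_apply, Finsupp.linearCombination_single]; ring
    refine ⟨isGaussian_of_map_eq_gaussianReal fun L => ?_⟩
    rw [AEMeasurable.map_map_of_aemeasurable L.continuous.measurable.aemeasurable hVI]
    have hL : (L ∘ fun ω => I.restrict (V · ω)) = fun ω =>
        (∑ i : I, L (Pi.single i 1) • m i).1 * circleMean (Y ω) +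
          Finsupp.linearCombination ℝ (fun x => Y ω x) (∑ i : I, L (Pi.single i 1) • m i).2 := by
      funext ω
      have h1 : I.restrict (V · ω) = ∑ i : I, V i ω • (Pi.single i 1 : I → ℝ) :=
        pi_eq_sum_univ' _
      rw [Function.comp_apply, h1, map_sum, Prod.fst_sum, Prod.snd_sum, map_sum, Finset.sum_mul,
        ← Finset.sum_add_distrib]
      refine Finset.sum_congr rfl fun i _ => ?_
      rw [map_smul, hm]
      simp only [Prod.smul_fst, Prod.smul_snd, map_smul, smul_eq_mul]
      ring
    rw [hL]
    exact ⟨_, _, (map_mean_add_linearCombination hY hmean hcov hK _ _).2⟩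

theorem variance_mean_add_linearCombination (hY : IsGaussianProcess (fun x ω => Y ω x) P)
    (hmean : ∀ x, ∫ ω, Y ω x ∂P = 0)
    (hcov : ∀ x y, ∫ ω, Y ω x * Y ω y ∂P = K (x - y)) (hK : circleMean K = 1)
    (c : ℝ) (g : UnitAddCircle →₀ ℝ) :
    Var[fun ω => c * circleMean (Y ω) + Finsupp.linearCombination ℝ (fun x => Y ω x) g; P] =
      c ^ 2 + 2 * c * Finsupp.linearCombination ℝ (fun _ => (1 : ℝ)) g +
        ∫ ω, Finsupp.linearCombination ℝ (fun x => Y ω x) g ^ 2 ∂P := by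
  obtain ⟨h0, hmap⟩ := map_mean_add_linearCombination hY hmean hcov hK c g
  have hm : AEMeasurable (fun ω => c * circleMean (Y ω) +
      Finsupp.linearCombination ℝ (fun x => Y ω x) g) P :=
    ((aemeasurable_circleMean hY).const_mul c).add
      (memLp_two_linearCombination hY g).aestronglyMeasurable.aemeasurable
  have h := (⟨hm, hmap⟩ : HasLaw _ _ P).variance_eq
  rw [h, variance_id_gaussianReal, Real.coe_toNNReal _ h0]

theorem map_circleMean (hY : IsGaussianProcess (fun x ω => Y ω x) P)
    (hmean : ∀ x, ∫ ω, Y ω x ∂P = 0)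
    (hcov : ∀ x y, ∫ ω, Y ω x * Y ω y ∂P = K (x - y)) (hK : circleMean K = 1) :
    P.map (fun ω => circleMean (Y ω)) = gaussianReal 0 1 := by
  simpa using (map_mean_add_linearCombination hY hmean hcov hK 1 0).2

/-- The mean has variance `1` and covariance `1` with every evaluation, hence covariance `0` with
`q̃`. Joint Gaussianity upgrades this to independence. -/
theorem indepFun_circleMean_meanZeroPart (hY : IsGaussianProcess (fun x ω => Y ω x) P)
    (hmean : ∀ x, ∫ ω, Y ω x ∂P = 0)
    (hcov : ∀ x y, ∫ ω, Y ω x * Y ω y ∂P = K (x - y)) (hK : circleMean K = 1) :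
    IndepFun (fun ω => circleMean (Y ω)) (fun ω => meanZeroPart (Y ω)) P := by
  have : IsProbabilityMeasure P := hY.isProbabilityMeasure
  have hV := isGaussianProcess_mean_meanZeroPart hY hmean hcov hK
  have hX : MemLp (fun ω => circleMean (Y ω)) 2 P :=
    (hV.hasGaussianLaw_eval (Sum.inl ())).memLp_two
  have hQ : ∀ x, MemLp (fun ω => (meanZeroPart (Y ω)).1 x) 2 P := fun x =>
    (hV.hasGaussianLaw_eval (Sum.inr x)).memLp_two
  have hind := hV.indepFun_of_covariance_eq_zero (fun _ => aemeasurable_circleMean hY)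
    (fun x => (hQ x).aestronglyMeasurable.aemeasurable) fun _ x => by
      have v1 := variance_mean_add_linearCombination hY hmean hcov hK 1 0
      have v2 := variance_mean_add_linearCombination hY hmean hcov hK 0 (Finsupp.single x 1)
      have v3 := variance_mean_add_linearCombination hY hmean hcov hK (-1) (Finsupp.single x 1)
      -- The covariance is read off from the variances of the mean, of `q̃(x)` and of their sum
      -- `q(x)`.
      have v4 := variance_fun_add hX (hQ x)
      simp only [Finsupp.linearCombination_single, map_zero, one_smul, one_mul, zero_mul, add_zero,
        zero_add] at v1 v2 v3
      have e1 : (fun ω => circleMean (Y ω) + (meanZeroPart (Y ω)).1 x) = fun ω => Y ω x :=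
        funext fun ω => by rw [meanZeroPart_apply]; ring
      have e2 : (fun ω => (meanZeroPart (Y ω)).1 x) = fun ω => -1 * circleMean (Y ω) + Y ω x :=
        funext fun ω => by rw [meanZeroPart_apply]; ring
      rw [e1, v1, v2] at v4
      rw [← e2] at v3
      rw [v3] at v4
      norm_num at v4
      linarith
  -- Independence is known for the family of evaluations; it passes to the `H`-valued variable,
  -- which is measurable for the σ-algebra they generate.
  rw [IndepFun_iff_Indep] at hind ⊢
  refine indep_of_indep_of_le_left (indep_of_indep_of_le_right hind ?_) ?_
  · refine measurable_iff_comap_le.1 ?_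
    refine @measurable_of_eval _ (MeasurableSpace.comap
      (fun ω (x : UnitAddCircle) => (meanZeroPart (Y ω)).1 x) MeasurableSpace.pi) _ fun x => ?_
    exact (measurable_pi_apply x).comp (comap_measurable _)
  · refine measurable_iff_comap_le.1 ?_
    exact (measurable_pi_apply ()).comp
      (comap_measurable fun ω (_ : Unit) => circleMean (Y ω))

end Gaussian

/-! ### The distribution of the ground state -/

theorem injOn_add_Phi_add_sq (lam : ℝ) (qt : MeanZeroPath) :
    Set.InjOn (fun s => lam + Phi s qt + s ^ 2) (Set.Ioi 0) :=
  (bijOn_Phi_add_sq lam qt).injOn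

theorem hasDerivAt_add_Phi_add_sq (lam : ℝ) {s : ℝ} (hs : 0 < s) (qt : MeanZeroPath) :
    HasDerivAt (fun t => lam + Phi t qt + t ^ 2) (jacobian s qt) s := by
  simpa only [add_assoc] using (hasDerivAt_Phi_add_sq hs qt).const_add lam

theorem setOf_lt_groundState (lam : ℝ) (qt : MeanZeroPath) :
    {q₀ : ℝ | lam < groundState (ContinuousMap.const _ q₀ + qt.1)} =
      Set.Ioi (lam + Phi 0 qt) := by
  ext q₀
  simp only [groundState_const_add, Set.mem_ofPred_eq, Set.mem_Ioi, lt_sub_iff_add_lt]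

theorem integrable_exp_neg_half_sq : Integrable fun x : ℝ => Real.exp (-(1 / 2) * x ^ 2) :=
  integrable_exp_neg_mul_sq (by norm_num)

theorem integrableOn_exp_mul_jacobian (lam : ℝ) (qt : MeanZeroPath) :
    IntegrableOn (fun s => Real.exp (-(1 / 2) * (lam + Phi s qt + s ^ 2) ^ 2) * jacobian s qt)
      (Set.Ioi 0) := by
  have h := (integrableOn_image_iff_integrableOn_abs_deriv_smul measurableSet_Ioi
    (fun s hs => (hasDerivAt_add_Phi_add_sq lam hs qt).hasDerivWithinAt)
    (injOn_add_Phi_add_sq lam qt) fun x => Real.exp (-(1 / 2) * x ^ 2)).1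
    integrable_exp_neg_half_sq.integrableOn
  refine h.congr_fun (fun s hs => ?_) measurableSet_Ioi
  simp only [smul_eq_mul, abs_of_pos (jacobian_pos hs qt), mul_comm]

/-- Change of variables `q₀ = lam + Φ + s²`, whose image is the half-line where the ground state
exceeds `lam`. -/
theorem integral_exp_mul_jacobian (lam : ℝ) (qt : MeanZeroPath) :
    ∫ s in Set.Ioi (0 : ℝ), Real.exp (-(1 / 2) * (lam + Phi s qt + s ^ 2) ^ 2) * jacobian s qt =
      ∫ x in Set.Ioi (lam + Phi 0 qt), Real.exp (-(1 / 2) * x ^ 2) := by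
  have h := integral_image_eq_integral_abs_deriv_smul measurableSet_Ioi
    (fun s hs => (hasDerivAt_add_Phi_add_sq lam hs qt).hasDerivWithinAt)
    (injOn_add_Phi_add_sq lam qt) fun x => Real.exp (-(1 / 2) * x ^ 2)
  rw [(bijOn_Phi_add_sq lam qt).image_eq, setOf_lt_groundState] at h
  rw [h]
  refine setIntegral_congr_fun measurableSet_Ioi fun s hs => ?_
  simp only [smul_eq_mul, abs_of_pos (jacobian_pos hs qt), mul_comm]

theorem gaussianReal_real_Ioi (a : ℝ) :
    (gaussianReal 0 1).real (Set.Ioi a) =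
      1 / Real.sqrt (2 * Real.pi) * ∫ x in Set.Ioi a, Real.exp (-(1 / 2) * x ^ 2) := by
  rw [measureReal_def, gaussianReal_apply_eq_integral 0 one_ne_zero, ENNReal.toReal_ofReal
    (integral_nonneg fun x => gaussianPDFReal_nonneg _ _ _), ← integral_const_mul]
  refine integral_congr_ae (Eventually.of_forall fun x => ?_)
  simp only [gaussianPDFReal, NNReal.coe_one, mul_one, sub_zero, one_div]
  congr 2
  ring

/-- Joint continuity on `s > 0` gives measurability. Each inner integral is a tail of the Gaussian
integral, so it is bounded uniformly in `q̃`. -/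
theorem integrable_exp_mul_jacobian (lam : ℝ) (ν : Measure MeanZeroPath) [IsProbabilityMeasure ν] :
    Integrable (fun z : MeanZeroPath × ℝ =>
      Real.exp (-(1 / 2) * (lam + Phi z.2 z.1 + z.2 ^ 2) ^ 2) * jacobian z.2 z.1)
      (ν.prod (volume.restrict (Set.Ioi 0))) := by
  have hmeas : AEStronglyMeasurable (fun z : MeanZeroPath × ℝ =>
      Real.exp (-(1 / 2) * (lam + Phi z.2 z.1 + z.2 ^ 2) ^ 2) * jacobian z.2 z.1)
      (ν.prod (volume.restrict (Set.Ioi 0))) := by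
    have hset : ν.prod (volume.restrict (Set.Ioi (0 : ℝ))) =
        (ν.prod volume).restrict {z : MeanZeroPath × ℝ | 0 < z.2} := by
      conv_lhs => rw [← Measure.restrict_univ (μ := ν)]
      rw [Measure.prod_restrict]
      congr 1
      ext z
      simp
    rw [hset]
    refine ContinuousOn.aestronglyMeasurable ?_ (measurableSet_lt measurable_const measurable_snd)
    refine ContinuousOn.mul ?_ continuousOn_jacobian
    refine Real.continuous_exp.comp_continuousOn (continuousOn_const.mul (ContinuousOn.pow ?_ 2))
    have h := continuousOn_const (c := lam).add (continuousOn_Phi_add_sq.mono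
      fun z (hz : 0 < z.2) => hz.le)
    exact h.congr fun z _ => add_assoc _ _ _
  rw [integrable_prod_iff hmeas]
  refine ⟨Eventually.of_forall fun qt => integrableOn_exp_mul_jacobian lam qt, ?_⟩
  refine Integrable.of_bound hmeas.norm.integral_prod_right' (∫ x, Real.exp (-(1 / 2) * x ^ 2))
    (Eventually.of_forall fun qt => ?_)
  have h : ∫ s in Set.Ioi (0 : ℝ),
      ‖Real.exp (-(1 / 2) * (lam + Phi s qt + s ^ 2) ^ 2) * jacobian s qt‖ =
      ∫ s in Set.Ioi (0 : ℝ), Real.exp (-(1 / 2) * (lam + Phi s qt + s ^ 2) ^ 2) * jacobian s qt :=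
    setIntegral_congr_fun measurableSet_Ioi fun s hs =>
      Real.norm_of_nonneg (mul_nonneg (Real.exp_pos _).le (jacobian_pos hs qt).le)
  simp only [h, integral_exp_mul_jacobian]
  rw [Real.norm_of_nonneg (integral_nonneg fun x => (Real.exp_pos _).le)]
  exact setIntegral_le_integral integrable_exp_neg_half_sq
    (Eventually.of_forall fun x => (Real.exp_pos _).le)

theorem continuous_Phi_zero : Continuous (Phi 0) := by
  have h := (continuousOn_Phi_add_sq.comp (f := fun qt : MeanZeroPath => (qt, (0 : ℝ)))
    (s := Set.univ) (continuous_id.prodMk continuous_const).continuousOn fun _ _ => le_refl (0 : ℝ))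
  rw [continuousOn_univ] at h
  exact h.congr fun qt => by simp

theorem groundState_eq (f : C(UnitAddCircle, ℝ)) :
    groundState f = circleMean f - Phi 0 (meanZeroPart f) := by
  rw [← groundState_const_add]
  congr 1
  ext x
  simp [meanZeroPart_apply]

theorem setOf_lt_groundState_path {Ω : Type*} (Y : Ω → C(UnitAddCircle, ℝ)) (lam : ℝ) :
    {ω | lam < groundState (Y ω)} = (fun ω => (circleMean (Y ω), meanZeroPart (Y ω))) ⁻¹'
      {z : ℝ × MeanZeroPath | lam + Phi 0 z.2 < z.1} := by
  ext ω
  simp only [groundState_eq, Set.mem_ofPred_eq, Set.mem_preimage, lt_sub_iff_add_lt]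

theorem measurableSet_add_Phi_lt (lam : ℝ) :
    MeasurableSet {z : ℝ × MeanZeroPath | lam + Phi 0 z.2 < z.1} :=
  measurableSet_lt (measurable_const.add (continuous_Phi_zero.measurable.comp measurable_snd))
    measurable_fst

section Gaussian

variable {Ω : Type*} [MeasurableSpace Ω] {P : Measure Ω} {Y : Ω → C(UnitAddCircle, ℝ)}
  {K : C(UnitAddCircle, ℝ)}

theorem nullMeasurableSet_lt_groundState (hY : IsGaussianProcess (fun x ω => Y ω x) P) (lam : ℝ) :
    NullMeasurableSet {ω | lam < groundState (Y ω)} P := by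
  rw [setOf_lt_groundState_path]
  exact ((aemeasurable_circleMean hY).prodMk (aemeasurable_meanZeroPart hY)).nullMeasurable
    (measurableSet_add_Phi_lt lam)

theorem measureReal_lt_groundState (hY : IsGaussianProcess (fun x ω => Y ω x) P)
    (hmean : ∀ x, ∫ ω, Y ω x ∂P = 0)
    (hcov : ∀ x y, ∫ ω, Y ω x * Y ω y ∂P = K (x - y)) (hK : circleMean K = 1) (lam : ℝ) :
    P.real {ω | lam < groundState (Y ω)} =
      1 / Real.sqrt (2 * Real.pi) *
        ∫ qt, (∫ s in Set.Ioi (0 : ℝ),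
          Real.exp (-(1 / 2) * (lam + Phi s qt + s ^ 2) ^ 2) * jacobian s qt)
          ∂(P.map fun ω => meanZeroPart (Y ω)) := by
  have : IsProbabilityMeasure P := hY.isProbabilityMeasure
  have hX := aemeasurable_circleMean hY
  have hQ := aemeasurable_meanZeroPart hY
  have : IsProbabilityMeasure (P.map fun ω => meanZeroPart (Y ω)) := P.isProbabilityMeasure_map hQ
  have hB := measurableSet_add_Phi_lt lam
  have hjoint := (indepFun_iff_map_prod_eq_prod_map_map hX hQ).1
    (indepFun_circleMean_meanZeroPart hY hmean hcov hK)
  rw [map_circleMean hY hmean hcov hK] at hjoint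
  -- The event is a measurable condition on the pair of mean and mean-zero part, whose law is a
  -- product. Fubini leaves, for each `q̃`, the Gaussian tail beyond `lam + Φ(0, q̃)`.
  rw [setOf_lt_groundState_path, measureReal_def,
    ← Measure.map_apply_of_aemeasurable (hX.prodMk hQ) hB, hjoint, Measure.prod_apply_symm hB,
    ← integral_toReal (measurable_measure_prodMk_right hB).aemeasurable
      (Eventually.of_forall fun _ => measure_lt_top _ _), ← integral_const_mul]
  refine integral_congr_ae (Eventually.of_forall fun qt => ?_)
  simp only [integral_exp_mul_jacobian]
  rw [← gaussianReal_real_Ioi]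
  rfl

end Gaussian

/-- One null set serves all `x` at once, so replacing `q` by its continuous version preserves the
Gaussian property. -/
theorem isGaussianProcess_samplePath {Ω : Type*} [MeasurableSpace Ω] {P : Measure Ω}
    {q : UnitAddCircle → Ω → ℝ} (hgauss : IsGaussianProcess q P)
    (hcont : ∀ᵐ ω ∂P, Continuous (fun x => q x ω)) :
    (∀ᵐ ω ∂P, ∀ x, samplePath q ω x = q x ω) ∧
      IsGaussianProcess (fun x ω => samplePath q ω x) P := by
  have h : ∀ᵐ ω ∂P, ∀ x, samplePath q ω x = q x ω := by
    filter_upwards [hcont] with ω hω x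
    rw [samplePath, dif_pos hω]
    rfl
  exact ⟨h, hgauss.congr fun x => h.mono fun ω hω => (hω x).symm⟩

theorem theorem3 {Ω : Type*} [MeasurableSpace Ω] (P : Measure Ω) [IsProbabilityMeasure P]
    (K : UnitAddCircle → ℝ) (hK : Continuous K) (hK1 : ∫ x, K x = 1)
    (q : UnitAddCircle → Ω → ℝ) (hgauss : IsGaussianProcess q P)
    (hcont : ∀ᵐ ω ∂P, Continuous (fun x => q x ω))
    (hmean : ∀ x, ∫ ω, q x ω ∂P = 0)
    (hcov : ∀ x y, ∫ ω, q x ω * q y ω ∂P = K (x - y))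
    (lam : ℝ) :
    -- the path `p̃` exists and is unique
    (∀ (qt : MeanZeroPath) (s : ℝ), 0 < s → ∃! p : ℝ → ℝ, IsRiccatiSolution s qt p) ∧
    -- at fixed `q̃`, `q₀ = lam + Φ + s²` identifies `{s > 0}` with `{Λ₀ > lam}`
    (∀ qt : MeanZeroPath,
      Set.BijOn (fun s : ℝ => lam + Phi s qt + s ^ 2) (Set.Ioi 0)
        {q₀ : ℝ | lam < groundState (ContinuousMap.const _ q₀ + qt.1)}) ∧
    -- `J` is the Jacobian `∂q₀/∂s`, and is positive
    (∀ (qt : MeanZeroPath) (s : ℝ), 0 < s →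
      0 < jacobian s qt ∧
        HasDerivAt (fun t : ℝ => lam + Phi t qt + t ^ 2) (jacobian s qt) s) ∧
    -- the distribution formula
    NullMeasurableSet {ω | lam < groundState (samplePath q ω)} P ∧
    Integrable
      (fun z : MeanZeroPath × ℝ =>
        Real.exp (-(1 / 2) * (lam + Phi z.2 z.1 + z.2 ^ 2) ^ 2) * jacobian z.2 z.1)
      ((meanZeroLaw P q).prod (volume.restrict (Set.Ioi 0))) ∧
    P.real {ω | lam < groundState (samplePath q ω)} =
      1 / Real.sqrt (2 * Real.pi) *
        ∫ qt, (∫ s in Set.Ioi (0 : ℝ),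
          Real.exp (-(1 / 2) * (lam + Phi s qt + s ^ 2) ^ 2) * jacobian s qt)
          ∂(meanZeroLaw P q) := by
  obtain ⟨heq, hY⟩ := isGaussianProcess_samplePath hgauss hcont
  have hmean' : ∀ x, ∫ ω, samplePath q ω x ∂P = 0 := fun x => by
    rw [← hmean x]
    exact integral_congr_ae (heq.mono fun ω hω => hω x)
  have hcov' : ∀ x y, ∫ ω, samplePath q ω x * samplePath q ω y ∂P =
      (⟨K, hK⟩ : C(UnitAddCircle, ℝ)) (x - y) := fun x y => by
    refine (integral_congr_ae (heq.mono fun ω hω => ?_)).trans (hcov x y)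
    simp only [hω]
  have hK' : circleMean ⟨K, hK⟩ = 1 := by rw [circleMean_eq_integral]; exact hK1
  have : IsProbabilityMeasure (meanZeroLaw P q) :=
    P.isProbabilityMeasure_map (aemeasurable_meanZeroPart hY)
  exact ⟨fun qt s hs => existsUnique_isRiccatiSolution hs.le qt, bijOn_Phi_add_sq lam,
    fun qt s hs => ⟨jacobian_pos hs qt, hasDerivAt_add_Phi_add_sq lam hs qt⟩,
    nullMeasurableSet_lt_groundState hY lam, integrable_exp_mul_jacobian lam _,
    measureReal_lt_groundState hY hmean' hcov' hK' lam⟩
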